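/- Let $U$ be a real separable Hilbert space and let $\Lambda:D(\Lambda)\subseteq U\to U$ be a self-adjoint operator of positive type (i.e. $\langle\Lambda x,x\rangle\ge\delta\|x\|^2$ for some $\delta>0$ and all $x\in D(\Lambda)$) with compact resolvent, whose eigenvalues are simple and form a sequence $(\mu_n)_{n\in\mathbb N}$ with $\mu_n\to\infty$. Let $\alpha\in(0,1)$, $\rho>0$, $\beta,\gamma\ge 0$, $T>0$. On $H:=U\times U$ let $$A=\begin{pmatrix}0&\Lambda^{1/2}\\-\Lambda^{1/2}&-\rho\Lambda^{\alpha}\end{pmatrix},\qquad D(A)=\{(h_1,h_2): h_2\in D(\Lambda^{1/2}),\ h_1+\rho\Lambda^{\alpha-\frac12}h_2\in D(\Lambda^{1/2})\},$$ that is, $A(h_1,h_2)=\big(\Lambda^{1/2}h_2,\,-\Lambda^{1/2}(h_1+\rho\Lambda^{\alpha-\frac12}h_2)\big)$, and let $G,\mathcal V:U\to H$ be the bounded operators $Gv=(0,\Lambda^{-\gamma}v)$, $\mathcal Vv=(0,\Lambda^{-\beta}v)$. Then $A$ generates a strongly continuous semigroup $(e^{tA})_{t\ge0}$ on $H$. For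 $t>0$ and $h\in H$ let $$\mathcal E_C(t,h)=\inf\Big\{\|u\|_{L^2(0,t;U)}:\ u\in L^2(0,t;U),\ e^{tA}h+\int_0^te^{(t-s)A}Gu(s)\,ds=0\Big\}$$ ($=\infty$ if there is no such $u$), and let $Q_t=\int_0^te^{sA}GG^*e^{sA^*}\,ds$. Put $$\theta=\frac12+\Big(\frac{\gamma-\beta}{\alpha}\vee0\Big)\ \text{ if }\alpha\in\big(0,\tfrac12\big],\qquad \theta=\frac12+\Big(\frac{\gamma-\beta}{1-\alpha}\vee0\Big)\ \text{ if }\alpha\in\big[\tfrac12,1\big).$$ There is a constant $c>0$, independent of $t$ and $v$ (it may depend on $T$ and on the data $\Lambda,\rho,\alpha,\beta,\gamma$), such that $$\mathcal E_C(t,\mathcal Vv)\le\frac{c\,\|v\|_U}{t^{\theta}},\qquad t\in(0,T],\ v\in U.$$ Moreover, for every $t\in(0,T]$, one has $e^{tA}(H)\subseteq Q_t^{1/2}(H)$, the operator $\Gamma_t:=Q_t^{-1/2}e^{tA}$ is bounded on $H$ (with $Q_t^{-1/2}$ the pseudo-inverse of $Q_t^{1/2}$), and $$\|\Gamma_t\mathcal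 V\|_{\mathcal L(U;H)}\le\frac{c}{t^{\theta}}.$$ -/

import Mathlib

open MeasureTheory Filter Topology Set
open scoped ENNReal InnerProductSpace

noncomputable section

namespace DampedControl

variable {U : Type*} [NormedAddCommGroup U] [InnerProductSpace ℝ U]

/-! ### The operator `Λ` and its powers -/

/-- `Λ` is a self-adjoint operator of positive type on the real Hilbert space `U`, with compact
resolvent, whose eigenvalues are exactly the pairwise distinct numbers `μ n`, all of them simple,
with (not necessarily normalized) eigenvectors `e n`, and with `μ n → ∞`. -/
structure IsPositiveDiscrete [CompleteSpace U] (Λ : U →ₗ.[ℝ] U) (μ : ℕ → ℝ) (e : ℕ → U) :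
    Prop where
  selfAdjoint : IsSelfAdjoint Λ
  positive : ∃ δ : ℝ, 0 < δ ∧ ∀ x : Λ.domain, δ * ‖(x : U)‖ ^ 2 ≤ ⟪Λ x, (x : U)⟫_ℝ
  compact_resolvent : ∃ (z : ℝ) (K : U →L[ℝ] U), IsCompactOperator K ∧
    (∀ x : U, ∃ hx : K x ∈ Λ.domain, z • K x - Λ ⟨K x, hx⟩ = x) ∧
    (∀ x : Λ.domain, K (z • (x : U) - Λ x) = x)
  ne_zero : ∀ n, e n ≠ 0
  eigen : ∀ n, ∃ hn : e n ∈ Λ.domain, Λ ⟨e n, hn⟩ = μ n • e n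
  simple : ∀ n, ∀ x : Λ.domain, Λ x = μ n • (x : U) → ∃ a : ℝ, (x : U) = a • e n
  injective : Function.Injective μ
  exhaust : ∀ (m : ℝ) (x : Λ.domain), (x : U) ≠ 0 → Λ x = m • (x : U) → ∃ n, m = μ n
  blow_up : Tendsto μ atTop atTop

/-- The graph of the power `Λ ^ s`: the pairs `(x, y)` such that for each eigenvector `f` of `Λ`,
with eigenvalue `m`, the coefficient of `y` along `f` is `m ^ s` times that of `x`. -/
def fracPowGraph (Λ : U →ₗ.[ℝ] U) (s : ℝ) : Submodule ℝ (U × U) where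
  carrier := {p | ∀ (m : ℝ) (f : Λ.domain), Λ f = m • (f : U) →
    ⟪(f : U), p.2⟫_ℝ = m ^ s * ⟪(f : U), p.1⟫_ℝ}
  zero_mem' := by
    intro m f _
    simp
  add_mem' := by
    intro p q hp hq m f hf
    simp only [Prod.snd_add, Prod.fst_add, inner_add_right, hp m f hf, hq m f hf, mul_add]
  smul_mem' := by
    intro a p hp m f hf
    simp only [Prod.smul_snd, Prod.smul_fst, inner_smul_right, hp m f hf]
    ring

/-- The (in general unbounded) power `Λ ^ s`, `s ∈ ℝ`, of a positive self-adjoint operator with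
compact resolvent. As the eigenvectors of such a `Λ` span a dense subspace, its domain consists of
those `x` for which `∑ (μ n ^ s ⟪x, ê n⟫)²` converges, and `Λ ^ s x = ∑ μ n ^ s ⟪x, ê n⟫ ê n`,
where `ê n` are the normalized eigenvectors. -/
def fracPow (Λ : U →ₗ.[ℝ] U) (s : ℝ) : U →ₗ.[ℝ] U :=
  (fracPowGraph Λ s).toLinearPMap

open Classical in
/-- An everywhere defined, bounded operator `T`, given as a partially defined one, as an element of
`U →L[ℝ] U` (and `0` by convention if `T` is not everywhere defined and bounded). -/
def toBounded (T : U →ₗ.[ℝ] U) : U →L[ℝ] U :=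
  if h : ∃ L : U →L[ℝ] U, ∀ x : U, (x, L x) ∈ T.graph then h.choose else 0

/-! ### The damped operator and the input operators on `H = U × U` -/

/-- The Hilbert space `U × U`, with `‖(h₁, h₂)‖² = ‖h₁‖² + ‖h₂‖²`. -/
abbrev Pair (U : Type*) : Type _ := WithLp 2 (U × U)

/-- The domain `{(h₁, h₂) : h₂ ∈ D(P) ∩ D(R), h₁ + ρ R h₂ ∈ D(P)}`. -/
def blockDomain (P R : U →ₗ.[ℝ] U) (ρ : ℝ) : Submodule ℝ (Pair U) where
  carrier := {h | h.snd ∈ P.domain ∧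
    ∃ hR : h.snd ∈ R.domain, h.fst + ρ • R ⟨h.snd, hR⟩ ∈ P.domain}
  zero_mem' := by
    refine ⟨P.domain.zero_mem, R.domain.zero_mem, ?_⟩
    have h0 : R ⟨(0 : Pair U).snd, R.domain.zero_mem⟩ = 0 := R.map_zero
    rw [h0, smul_zero, add_zero]
    exact P.domain.zero_mem
  add_mem' := by
    rintro h k ⟨h1, h2, h3⟩ ⟨k1, k2, k3⟩
    refine ⟨P.domain.add_mem h1 k1, R.domain.add_mem h2 k2, ?_⟩
    have hadd : R ⟨(h + k).snd, R.domain.add_mem h2 k2⟩ = R ⟨h.snd, h2⟩ + R ⟨k.snd, k2⟩ :=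
      R.map_add ⟨h.snd, h2⟩ ⟨k.snd, k2⟩
    rw [hadd, WithLp.add_fst, smul_add, add_add_add_comm]
    exact P.domain.add_mem h3 k3
  smul_mem' := by
    rintro a h ⟨h1, h2, h3⟩
    refine ⟨P.domain.smul_mem a h1, R.domain.smul_mem a h2, ?_⟩
    have hsmul : R ⟨(a • h).snd, R.domain.smul_mem a h2⟩ = a • R ⟨h.snd, h2⟩ :=
      R.map_smul a ⟨h.snd, h2⟩
    rw [hsmul, WithLp.smul_fst, smul_comm ρ a, ← smul_add]
    exact P.domain.smul_mem a h3

/-- The operator `A (h₁, h₂) = (P h₂, - P (h₁ + ρ R h₂))` with domain `blockDomain P R ρ`. -/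
def blockOperator (P R : U →ₗ.[ℝ] U) (ρ : ℝ) : Pair U →ₗ.[ℝ] Pair U where
  domain := blockDomain P R ρ
  toFun :=
    { toFun := fun h => WithLp.toLp 2
        (P ⟨h.1.snd, h.2.1⟩, - P ⟨h.1.fst + ρ • R ⟨h.1.snd, h.2.2.1⟩, h.2.2.2⟩)
      map_add' := by
        intro h k
        have hadd : R ⟨(h + k).1.snd, (h + k).2.2.1⟩ =
            R ⟨h.1.snd, h.2.2.1⟩ + R ⟨k.1.snd, k.2.2.1⟩ :=
          R.map_add ⟨h.1.snd, h.2.2.1⟩ ⟨k.1.snd, k.2.2.1⟩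
        have h1 : P ⟨(h + k).1.snd, (h + k).2.1⟩ = P ⟨h.1.snd, h.2.1⟩ + P ⟨k.1.snd, k.2.1⟩ :=
          P.map_add ⟨h.1.snd, h.2.1⟩ ⟨k.1.snd, k.2.1⟩
        have h2 : P ⟨(h + k).1.fst + ρ • R ⟨(h + k).1.snd, (h + k).2.2.1⟩, (h + k).2.2.2⟩ =
            P ⟨h.1.fst + ρ • R ⟨h.1.snd, h.2.2.1⟩, h.2.2.2⟩ +
              P ⟨k.1.fst + ρ • R ⟨k.1.snd, k.2.2.1⟩, k.2.2.2⟩ := by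
          rw [← P.map_add]
          congr 1
          apply Subtype.ext
          change (h + k).1.fst + ρ • R ⟨(h + k).1.snd, (h + k).2.2.1⟩ =
            (h.1.fst + ρ • R ⟨h.1.snd, h.2.2.1⟩) + (k.1.fst + ρ • R ⟨k.1.snd, k.2.2.1⟩)
          rw [hadd, Submodule.coe_add, WithLp.add_fst, smul_add, add_add_add_comm]
        rw [h1, h2, ← WithLp.toLp_add, Prod.mk_add_mk, neg_add]
      map_smul' := by
        intro a h
        have hsmul : R ⟨(a • h).1.snd, (a • h).2.2.1⟩ = a • R ⟨h.1.snd, h.2.2.1⟩ :=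
          R.map_smul a ⟨h.1.snd, h.2.2.1⟩
        have h1 : P ⟨(a • h).1.snd, (a • h).2.1⟩ = a • P ⟨h.1.snd, h.2.1⟩ :=
          P.map_smul a ⟨h.1.snd, h.2.1⟩
        have h2 : P ⟨(a • h).1.fst + ρ • R ⟨(a • h).1.snd, (a • h).2.2.1⟩, (a • h).2.2.2⟩ =
            a • P ⟨h.1.fst + ρ • R ⟨h.1.snd, h.2.2.1⟩, h.2.2.2⟩ := by
          rw [← P.map_smul]
          congr 1
          apply Subtype.ext
          change (a • h).1.fst + ρ • R ⟨(a • h).1.snd, (a • h).2.2.1⟩ =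
            a • (h.1.fst + ρ • R ⟨h.1.snd, h.2.2.1⟩)
          rw [hsmul, Submodule.coe_smul, WithLp.smul_fst, smul_add, smul_comm ρ a]
        rw [h1, h2, RingHom.id_apply, ← WithLp.toLp_smul, Prod.smul_mk, smul_neg] }

/-- The damped operator `A = (0, Λ^{1/2}; -Λ^{1/2}, -ρ Λ^α)`, with domain
`{(h₁, h₂) : h₂ ∈ D(Λ^{1/2}), h₁ + ρ Λ^{α - 1/2} h₂ ∈ D(Λ^{1/2})}`. -/
def dampedOperator (Λ : U →ₗ.[ℝ] U) (ρ α : ℝ) : Pair U →ₗ.[ℝ] Pair U :=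
  blockOperator (fracPow Λ (1 / 2)) (fracPow Λ (α - 1 / 2)) ρ

/-- The bounded operator `U → U × U`, `v ↦ (0, Λ^{-s} v)`, for `s ≥ 0`. -/
def inputOperator (Λ : U →ₗ.[ℝ] U) (s : ℝ) : U →L[ℝ] Pair U :=
  ((WithLp.prodContinuousLinearEquiv 2 ℝ U U).symm : U × U →L[ℝ] Pair U) ∘L
    ContinuousLinearMap.inr ℝ U U ∘L toBounded (fracPow Λ (-s))

/-! ### Strongly continuous semigroups, null controls, and the operator `Γ_t` -/

variable {H : Type*} [NormedAddCommGroup H] [InnerProductSpace ℝ H]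

/-- `S t`, `t ≥ 0`, is the strongly continuous semigroup generated by `A`. Only the values of `S`
on `[0, ∞)` play a role. -/
structure IsSemigroupOf (A : H →ₗ.[ℝ] H) (S : ℝ → H →L[ℝ] H) : Prop where
  zero : S 0 = ContinuousLinearMap.id ℝ H
  add : ∀ s t : ℝ, 0 ≤ s → 0 ≤ t → S (s + t) = S s ∘L S t
  continuous : ∀ x : H, ContinuousOn (fun t => S t x) (Ici 0)
  generator : ∀ x y : H, (x, y) ∈ A.graph ↔
    Tendsto (fun t : ℝ => t⁻¹ • (S t x - x)) (𝓝[>] 0) (𝓝 y)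

/-- The mild solution of `Y' = A Y + G u`, `Y 0 = h`, at time `τ`. -/
def mildSolution (S : ℝ → H →L[ℝ] H) (G : U →L[ℝ] H) (h : H) (u : ℝ → U) (τ : ℝ) : H :=
  S τ h + ∫ s in (0 : ℝ)..τ, S (τ - s) (G (u s))

/-- The controls `u ∈ L²(0, t; U)` that steer `h` to `0` at time `t`. -/
def nullControls (S : ℝ → H →L[ℝ] H) (G : U →L[ℝ] H) (t : ℝ) (h : H) : Set (ℝ → U) :=
  {u | MemLp u 2 (volume.restrict (Icc 0 t)) ∧ mildSolution S G h u t = 0}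

/-- The minimal energy `E_C(t, h)`, the infimum of the `L²(0, t; U)` norms of the controls steering
`h` to `0` at time `t` (`∞` if there is none). -/
def minEnergy (S : ℝ → H →L[ℝ] H) (G : U →L[ℝ] H) (t : ℝ) (h : H) : ℝ≥0∞ :=
  ⨅ u ∈ nullControls S G t h, eLpNorm u 2 (volume.restrict (Icc 0 t))

/-- The controllability Gramian `Q_t h = ∫_0^t e^{sA} G G* e^{sA*} h ds`. -/
def gramian [CompleteSpace U] [CompleteSpace H] (S : ℝ → H →L[ℝ] H) (G : U →L[ℝ] H) (t : ℝ)
    (h : H) : H :=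
  ∫ s in (0 : ℝ)..t, S s (G (G.adjoint ((S s).adjoint h)))

/-- `R` is the nonnegative self-adjoint square root of `Q`. -/
def IsSqrtOf [CompleteSpace H] (R : H →L[ℝ] H) (Q : H → H) : Prop :=
  R.IsPositive ∧ ∀ h, R (R h) = Q h

/-- `Γ = Q_t^{-1/2} e^{tA}` as an everywhere defined bounded operator, where `Q_t^{-1/2}` is the
(pseudo-)inverse of `Q_t^{1/2}`: `Q_t^{-1/2} y` is the preimage of `y` under `Q_t^{1/2}` that is
orthogonal to the kernel. Since `Q_t^{1/2}` is unique, there is at most one such `Γ`; its existence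
includes that `e^{tA}(H) ⊆ Q_t^{1/2}(H)`. -/
def IsGammaOperator [CompleteSpace U] [CompleteSpace H] (S : ℝ → H →L[ℝ] H) (G : U →L[ℝ] H)
    (t : ℝ) (Γ : H →L[ℝ] H) : Prop :=
  ∃ R : H →L[ℝ] H, IsSqrtOf R (gramian S G t) ∧
    ∀ h : H, R (Γ h) = S t h ∧ Γ h ∈ (LinearMap.ker (R : H →ₗ[ℝ] H))ᗮ

/-- The exponent `1/2 + ((γ - β)/α ∨ 0)` for `α ≤ 1/2`, `1/2 + ((γ - β)/(1 - α) ∨ 0)` for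
`α ≥ 1/2`; the two agree for `α = 1/2`. -/
def controlExponent (α β γ : ℝ) : ℝ :=
  if α ≤ 1 / 2 then 1 / 2 + max ((γ - β) / α) 0 else 1 / 2 + max ((γ - β) / (1 - α)) 0

end DampedControl

end

/-!
The normalized eigenvectors of `Λ` form an orthonormal basis of `U`
(`IsPositiveDiscrete.exists_hilbertBasis`): they span the eigenspaces of the compact symmetric
resolvent. In the resulting coordinates on `U × U` the damped operator is block-diagonal
(`mem_graph_dampedOperator`), and the block of the eigenvalue `m` is the damped oscillator
`h₁' = ω h₂`, `h₂' = -ω h₁ - a h₂` with `ω = √m`, `a = ρ m ^ α`. The blocks are dissipative, so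
that the operator generates a semigroup, and every semigroup it generates consists of the flows of
the oscillators (`exists_isSemigroupOf`, `IsSemigroupOf.isBlockDiag`). What remains is to steer a
single oscillator to rest, with bounds that are uniform in `m ≥ δ`.

*Control.* Let `(h₁, h₂)` be a free trajectory and `χ` a cutoff on `[0, t]` that is `1` on the first
half and vanishes at time `t`. The state `(χ h₁, χ h₂ + χ' h₁ / ω)` solves the equation forced by
`2 χ' h₂ + χ'' h₁ / ω + (a / ω) χ' h₁` and comes to rest at time `t`
(`flow_add_integral_steering`).

*Decay.* No case distinction between underdamped and overdamped oscillators is needed: with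
`d = a / ω`, the function `2 h₁² + h₂² + (h₂ + d h₁)²` has derivative `-2 a (h₁² + h₂²)` along
free trajectories, so it decays at the rate `2 a / (3 + 2 d²)`, which is of order at least `m ^ r`
with `r = min (α, 1 - α)` (`energy_flow_le`, `exists_le_decayRate`). It also controls `d |h₁|`.
Starting from `(0, v)` the force is therefore at most `K t⁻¹ exp (-k m ^ r t) |v|`
(`exists_steering_le`). As it acts only on the second half of `[0, t]`, the decay absorbs the
factor `m ^ (γ - β)` due to the two operators `Λ ^ (-γ)`, `Λ ^ (-β)`, at the price of
`t ^ (-((γ - β) / r ∨ 0))`. The norm in `L²(0, t)` contributes the factor `√t`, which yields the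
exponent `θ`.

*The operator `Γ`.* The Gramian is block-diagonal as well. By duality between steering and
observation each block is invertible, and `‖Γ z‖` is at most the energy of any control that steers
`z` to rest (`exists_gamma_of_steers`), so the same controls bound `Γ`.
-/

noncomputable section

namespace DampedControl

/-! ### Block-diagonal operators in square-summable coordinates -/

/-- The Hilbert space of square-summable sequences in `E`. A Hilbert space `H` that is the
orthogonal sum of countably many copies of `E` is handled through an isometry
`Φ : H ≃ₗᵢ[ℝ] SeqL2 E`, so that `Φ x n` is the component of `x` in the `n`-th copy. -/
abbrev SeqL2 (E : Type*) [NormedAddCommGroup E] := lp (fun _ : ℕ => E) 2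

variable {H K E F : Type*} [NormedAddCommGroup H] [InnerProductSpace ℝ H]
  [NormedAddCommGroup K] [InnerProductSpace ℝ K]
  [NormedAddCommGroup E] [InnerProductSpace ℝ E] [NormedAddCommGroup F] [InnerProductSpace ℝ F]
  (Φ : H ≃ₗᵢ[ℝ] SeqL2 E) (Ψ : K ≃ₗᵢ[ℝ] SeqL2 F)

lemma hasSum_norm_sq_coords (x : H) : HasSum (fun n => ‖Φ x n‖ ^ 2) (‖x‖ ^ 2) := by
  have h := lp.hasSum_norm (p := 2) (by norm_num) (Φ x)
  simpa [Φ.norm_map] using h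

lemma summable_norm_sq_coords (x : H) : Summable (fun n => ‖Φ x n‖ ^ 2) :=
  (hasSum_norm_sq_coords Φ x).summable

lemma memlp_two_of_summable {E : Type*} [NormedAddCommGroup E] {z : ℕ → E}
    (hz : Summable fun n => ‖z n‖ ^ 2) : Memℓp z 2 :=
  memℓp_gen (by simpa using hz)

lemma exists_coords_eq {z : ℕ → E} (hz : Summable fun n => ‖z n‖ ^ 2) :
    ∃ x : H, ∀ n, Φ x n = z n :=
  ⟨Φ.symm ⟨z, memlp_two_of_summable hz⟩, fun n => by simp⟩

lemma ext_coords {x y : H} (h : ∀ n, Φ x n = Φ y n) : x = y :=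
  Φ.injective (lp.ext (funext h))

/-- The `n`-th component as a bounded operator. -/
def coordCLM (n : ℕ) : H →L[ℝ] E :=
  (lp.evalCLM ℝ (fun _ : ℕ => E) 2 n) ∘L (Φ.toContinuousLinearEquiv : H →L[ℝ] SeqL2 E)

lemma coords_sub (x y : H) (n : ℕ) : Φ (x - y) n = Φ x n - Φ y n := by
  rw [map_sub]; rfl

lemma coords_smul (c : ℝ) (x : H) (n : ℕ) : Φ (c • x) n = c • Φ x n := by
  rw [map_smul]; rfl

/-- The vector whose `n`-th component is `z` and whose other components vanish. -/
def blockVec (n : ℕ) (z : E) : H := Φ.symm (lp.single 2 n z)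

lemma blockVec_coord_self (n : ℕ) (z : E) : Φ (blockVec Φ n z) n = z := by
  simp [blockVec]

lemma blockVec_coord_ne {n m : ℕ} (h : m ≠ n) (z : E) : Φ (blockVec Φ n z) m = 0 := by
  simp [blockVec, Pi.single_eq_of_ne h]

lemma inner_blockVec_left (n : ℕ) (z : E) (x : H) : ⟪blockVec Φ n z, x⟫_ℝ = ⟪z, Φ x n⟫_ℝ := by
  rw [← Φ.inner_map_map, blockVec, Φ.apply_symm_apply, lp.inner_single_left]

lemma hasSum_inner_coords (x y : H) : HasSum (fun n => ⟪Φ x n, Φ y n⟫_ℝ) ⟪x, y⟫_ℝ := by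
  rw [← Φ.inner_map_map]
  exact lp.hasSum_inner (Φ x) (Φ y)

lemma hasSum_blockVec (x : H) : HasSum (fun n => blockVec Φ n (Φ x n)) x := by
  have h := lp.hasSum_single (p := 2) (by norm_num) (Φ x)
  have h2 := h.mapL (Φ.symm.toContinuousLinearEquiv : SeqL2 E →L[ℝ] H)
  simpa [blockVec] using h2

lemma ext_blockVec {G : Type*} [NormedAddCommGroup G] [NormedSpace ℝ G] {A B : H →L[ℝ] G}
    (h : ∀ n z, A (blockVec Φ n z) = B (blockVec Φ n z)) : A = B := by
  ext x
  have hA := (hasSum_blockVec Φ x).mapL A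
  have hB := (hasSum_blockVec Φ x).mapL B
  simp only [h] at hA
  exact hA.unique hB

lemma norm_le_of_coords {C : ℝ} (hC : 0 ≤ C) {x : H} {y : K}
    (h : ∀ n, ‖Ψ y n‖ ≤ C * ‖Φ x n‖) : ‖y‖ ≤ C * ‖x‖ := by
  refine le_of_sq_le_sq ?_ (by positivity)
  rw [mul_pow]
  refine hasSum_le (fun n => ?_) (hasSum_norm_sq_coords Ψ y)
    ((hasSum_norm_sq_coords Φ x).mul_left (C ^ 2))
  rw [← mul_pow]
  exact pow_le_pow_left₀ (norm_nonneg _) (h n) 2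

/-- `D` acts componentwise, by `T n` on the `n`-th component. -/
def IsBlockDiag (D : H →L[ℝ] K) (T : ℕ → E →L[ℝ] F) : Prop :=
  ∀ x n, Ψ (D x) n = T n (Φ x n)

lemma exists_isBlockDiag (T : ℕ → E →L[ℝ] F) {C : ℝ} (hT : ∀ n z, ‖T n z‖ ≤ C * ‖z‖) :
    ∃ D : H →L[ℝ] K, IsBlockDiag Φ Ψ D T := by
  have hC : ∀ n z, ‖T n z‖ ≤ max C 0 * ‖z‖ := fun n z =>
    (hT n z).trans (mul_le_mul_of_nonneg_right (le_max_left _ _) (norm_nonneg _))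
  have hs : ∀ x : H, ∃ y : K, ∀ n, Ψ y n = T n (Φ x n) := fun x => by
    refine exists_coords_eq Ψ (Summable.of_nonneg_of_le (fun n => by positivity) (fun n => ?_)
      ((summable_norm_sq_coords Φ x).mul_left (max C 0 ^ 2)))
    rw [← mul_pow]
    exact pow_le_pow_left₀ (norm_nonneg _) (hC n _) 2
  choose f hf using hs
  refine ⟨LinearMap.mkContinuous
    { toFun := f
      map_add' := fun x y => ext_coords Ψ fun n => by simp [hf]
      map_smul' := fun c x => ext_coords Ψ fun n => by simp [hf] } (max C 0) fun x => ?_, ?_⟩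
  · exact norm_le_of_coords Φ Ψ (le_max_right _ _) fun n => by
      simpa [hf] using hC n (Φ x n)
  · intro x n
    exact hf x n

lemma IsBlockDiag.apply_blockVec {Φ : H ≃ₗᵢ[ℝ] SeqL2 E} {Ψ : K ≃ₗᵢ[ℝ] SeqL2 F}
    {D : H →L[ℝ] K} {T : ℕ → E →L[ℝ] F} (h : IsBlockDiag Φ Ψ D T) (n : ℕ) (z : E) :
    D (blockVec Φ n z) = blockVec Ψ n (T n z) := by
  refine ext_coords Ψ fun m => ?_
  rw [h]
  by_cases hm : m = n
  · subst hm; rw [blockVec_coord_self, blockVec_coord_self]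
  · rw [blockVec_coord_ne Φ hm, blockVec_coord_ne Ψ hm, map_zero]

lemma IsBlockDiag.adjoint [CompleteSpace H] [CompleteSpace K] [CompleteSpace E] [CompleteSpace F]
    {Φ : H ≃ₗᵢ[ℝ] SeqL2 E} {Ψ : K ≃ₗᵢ[ℝ] SeqL2 F}
    {D : H →L[ℝ] K} {T : ℕ → E →L[ℝ] F} (h : IsBlockDiag Φ Ψ D T) :
    IsBlockDiag Ψ Φ D.adjoint (fun n => (T n).adjoint) := by
  intro y n
  refine ext_inner_left ℝ fun z => ?_
  rw [← inner_blockVec_left, ContinuousLinearMap.adjoint_inner_right, h.apply_blockVec, inner_blockVec_left,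
    ContinuousLinearMap.adjoint_inner_right]

/-- Dominated convergence for sums of squares: componentwise convergence under a
square-summable bound is convergence in norm. -/
lemma tendsto_of_coords {ι : Type*} {l : Filter ι} {f : ι → H} {y : H} {g : ℕ → ℝ}
    (hg : Summable fun n => g n ^ 2)
    (hlim : ∀ n, Tendsto (fun i => Φ (f i) n) l (𝓝 (Φ y n)))
    (hb : ∀ᶠ i in l, ∀ n, ‖Φ (f i) n - Φ y n‖ ≤ g n) : Tendsto f l (𝓝 y) := by
  rw [tendsto_iff_norm_sub_tendsto_zero]
  have hsq : Tendsto (fun i => ‖f i - y‖ ^ 2) l (𝓝 0) := by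
    have h := tendsto_tsum_of_dominated_convergence (𝓕 := l)
      (f := fun i n => ‖Φ (f i) n - Φ y n‖ ^ 2) (g := fun _ => (0 : ℝ)) hg
      (fun n => by
        have := ((tendsto_iff_norm_sub_tendsto_zero.1 (hlim n)).pow 2)
        simpa using this)
      (by
        filter_upwards [hb] with i hi n
        rw [Real.norm_of_nonneg (by positivity)]
        exact pow_le_pow_left₀ (norm_nonneg _) (hi n) 2)
    rw [tsum_zero] at h
    refine h.congr fun i => ?_
    rw [← (hasSum_norm_sq_coords Φ (f i - y)).tsum_eq]
    simp
  have := hsq.sqrt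
  simpa [Real.sqrt_sq] using this

lemma continuousOn_of_coords {X : Type*} [TopologicalSpace X] {s : Set X} {f : X → H} {g : ℕ → ℝ}
    (hg : Summable fun n => g n ^ 2) (hc : ∀ n, ContinuousOn (fun t => Φ (f t) n) s)
    (hb : ∀ t ∈ s, ∀ n, ‖Φ (f t) n‖ ≤ g n) : ContinuousOn f s := by
  intro t ht
  refine tendsto_of_coords Φ (g := fun n => 2 * g n) ?_ (fun n => hc n t ht) ?_
  · simpa [mul_pow] using hg.mul_left (2 ^ 2)
  · filter_upwards [self_mem_nhdsWithin] with i hi n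
    calc _ ≤ ‖Φ (f i) n‖ + ‖Φ (f t) n‖ := norm_sub_le _ _
      _ ≤ 2 * g n := by linarith [hb i hi n, hb t ht n]

/-! ### Diagonalization of `Λ`, of its powers and of the damped operator -/

section Spectral

variable {U : Type*} [NormedAddCommGroup U] [InnerProductSpace ℝ U]

section Diagonalization

variable [CompleteSpace U] {Λ : U →ₗ.[ℝ] U} {μ : ℕ → ℝ} {e : ℕ → U}

lemma IsPositiveDiscrete.inner_map_left (h : IsPositiveDiscrete Λ μ e) (x y : Λ.domain) :
    ⟪Λ x, (y : U)⟫_ℝ = ⟪(x : U), Λ y⟫_ℝ := by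
  have h1 := LinearPMap.adjoint_isFormalAdjoint h.selfAdjoint.dense_domain
  rw [LinearPMap.isSelfAdjoint_def.1 h.selfAdjoint] at h1
  exact h1 x y

lemma IsPositiveDiscrete.exists_lower_bound (h : IsPositiveDiscrete Λ μ e) :
    ∃ δ : ℝ, 0 < δ ∧ ∀ n, δ ≤ μ n := by
  obtain ⟨δ, hδ, hp⟩ := h.positive
  refine ⟨δ, hδ, fun n => ?_⟩
  obtain ⟨hn, he⟩ := h.eigen n
  have h1 := hp ⟨e n, hn⟩
  rw [he, real_inner_smul_left, real_inner_self_eq_norm_sq] at h1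
  have h2 : 0 < ‖e n‖ ^ 2 := by have := norm_pos_iff.2 (h.ne_zero n); positivity
  exact le_of_mul_le_mul_right h1 h2

/-- The normalized eigenvectors form an orthonormal basis: they span the eigenspaces of the
compact symmetric resolvent `K`, whose orthogonal complement is trivial. -/
lemma IsPositiveDiscrete.exists_hilbertBasis (h : IsPositiveDiscrete Λ μ e) :
    ∃ b : HilbertBasis ℕ ℝ U, ∀ n, b n = ‖e n‖⁻¹ • e n := by
  have hon : Orthonormal ℝ (fun n => ‖e n‖⁻¹ • e n) := by
    refine ⟨fun n => norm_smul_inv_norm (h.ne_zero n), fun m n hmn => ?_⟩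
    obtain ⟨hm, hem⟩ := h.eigen m
    obtain ⟨hn, hen⟩ := h.eigen n
    have h1 := h.inner_map_left ⟨e m, hm⟩ ⟨e n, hn⟩
    rw [hem, hen, real_inner_smul_left, real_inner_smul_right] at h1
    have h2 : μ m - μ n ≠ 0 := sub_ne_zero.2 fun hh => hmn (h.injective hh)
    have h3 : ⟪e m, e n⟫_ℝ = 0 :=
      (mul_eq_zero.1 (by linarith : (μ m - μ n) * ⟪e m, e n⟫_ℝ = 0)).resolve_left h2
    simp [real_inner_smul_left, real_inner_smul_right, h3]
  obtain ⟨z, K, hK, hK1, hK2⟩ := h.compact_resolvent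
  have hsymm : (K : U →ₗ[ℝ] U).IsSymmetric := by
    intro x y
    obtain ⟨hx, hx'⟩ := hK1 x
    obtain ⟨hy, hy'⟩ := hK1 y
    change ⟪K x, y⟫_ℝ = ⟪x, K y⟫_ℝ
    have h1 := h.inner_map_left ⟨K x, hx⟩ ⟨K y, hy⟩
    dsimp only at h1
    calc ⟪K x, y⟫_ℝ = ⟪K x, z • K y - Λ ⟨K y, hy⟩⟫_ℝ := by rw [hy']
      _ = ⟪z • K x - Λ ⟨K x, hx⟩, K y⟫_ℝ := by
        rw [inner_sub_left, inner_sub_right, h1, real_inner_smul_left, real_inner_smul_right]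
      _ = ⟪x, K y⟫_ℝ := by rw [hx']
  have hbot := ContinuousLinearMap.orthogonalComplement_iSup_eigenspaces_eq_bot hK hsymm
  have hspan : (⨆ m, Module.End.eigenspace (K : Module.End ℝ U) m) ≤
      Submodule.span ℝ (Set.range fun n => ‖e n‖⁻¹ • e n) := by
    refine iSup_le fun m x hx => ?_
    rw [Module.End.mem_eigenspace_iff] at hx
    change K x = m • x at hx
    obtain ⟨hxd, hx'⟩ := hK1 x
    rcases eq_or_ne x 0 with rfl | hx0
    · exact Submodule.zero_mem _
    have hm : m ≠ 0 := by
      rintro rfl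
      apply hx0
      have h0 : (⟨K x, hxd⟩ : Λ.domain) = 0 := Subtype.ext (by simp [hx])
      rw [← hx', h0, hx, LinearPMap.map_zero]
      simp
    have hxd' : x ∈ Λ.domain := by
      have := Λ.domain.smul_mem m⁻¹ hxd
      rwa [hx, smul_smul, inv_mul_cancel₀ hm, one_smul] at this
    have hΛ : Λ ⟨x, hxd'⟩ = (z - m⁻¹) • x := by
      have h0 : (⟨K x, hxd⟩ : Λ.domain) = m • ⟨x, hxd'⟩ := Subtype.ext hx
      rw [h0, LinearPMap.map_smul, hx] at hx'
      have h1 : m • ((z - m⁻¹) • x - Λ ⟨x, hxd'⟩) = 0 := by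
        rw [smul_sub, smul_smul, mul_sub, mul_inv_cancel₀ hm, sub_smul, one_smul]
        nth_rewrite 2 [← hx']
        rw [smul_smul, mul_comm]
        abel
      exact (sub_eq_zero.1 ((smul_eq_zero.1 h1).resolve_left hm)).symm
    obtain ⟨n, hn⟩ := h.exhaust _ ⟨x, hxd'⟩ hx0 hΛ
    obtain ⟨a, ha⟩ := h.simple n ⟨x, hxd'⟩ (by rw [← hn]; exact hΛ)
    have hne : ‖e n‖ ≠ 0 := norm_ne_zero_iff.2 (h.ne_zero n)
    have : x = (a * ‖e n‖) • (‖e n‖⁻¹ • e n) := by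
      rw [smul_smul, mul_assoc, mul_inv_cancel₀ hne, mul_one]; exact ha
    rw [this]
    exact Submodule.smul_mem _ _ (Submodule.subset_span ⟨n, rfl⟩)
  have hcompl : (Submodule.span ℝ (Set.range fun n => ‖e n‖⁻¹ • e n))ᗮ = ⊥ :=
    le_bot_iff.1 ((Submodule.orthogonal_le hspan).trans hbot.le)
  exact ⟨HilbertBasis.mkOfOrthogonalEqBot hon hcompl, fun n => by simp⟩

/-- Coordinates in which every power `Λ ^ s` is multiplication by `μ n ^ s`. -/
lemma IsPositiveDiscrete.exists_coords (h : IsPositiveDiscrete Λ μ e) :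
    ∃ Φ : U ≃ₗᵢ[ℝ] SeqL2 ℝ, ∀ (s : ℝ) (x y : U),
      (x, y) ∈ (fracPow Λ s).graph ↔ ∀ n, Φ y n = μ n ^ s * Φ x n := by
  obtain ⟨b, hb⟩ := h.exists_hilbertBasis
  have hmem : ∀ (s : ℝ) (x y : U), (x, y) ∈ fracPowGraph Λ s ↔
      ∀ n, b.repr y n = μ n ^ s * b.repr x n := by
    intro s x y
    simp only [b.repr_apply_apply]
    constructor
    · intro hxy n
      obtain ⟨hn, he⟩ := h.eigen n
      have h1 := hxy (μ n) ⟨e n, hn⟩ he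
      dsimp only at h1
      rw [hb, real_inner_smul_left, real_inner_smul_left, h1]
      ring
    · intro hxy m f hf
      rcases eq_or_ne (f : U) 0 with h0 | h0
      · simp [h0]
      obtain ⟨n, rfl⟩ := h.exhaust m f h0 hf
      obtain ⟨a, ha⟩ := h.simple n f hf
      have hne : ‖e n‖ ≠ 0 := norm_ne_zero_iff.2 (h.ne_zero n)
      have h2 : (f : U) = (a * ‖e n‖) • b n := by
        rw [ha, hb, smul_smul, mul_assoc, mul_inv_cancel₀ hne, mul_one]
      dsimp only
      rw [h2, real_inner_smul_left, real_inner_smul_left, hxy n]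
      ring
  refine ⟨b.repr, fun s x y => ?_⟩
  rw [fracPow, Submodule.toLinearPMap_graph_eq, hmem]
  rintro ⟨x, y⟩ hxy (hx : x = 0)
  subst hx
  refine ext_coords b.repr fun n => ?_
  rw [(hmem s 0 y).1 hxy n]
  simp

end Diagonalization

lemma pair_ext {V : Type*} {y z : Pair V} (h1 : y.fst = z.fst) (h2 : y.snd = z.snd) : y = z :=
  (WithLp.ofLp_injective 2) (Prod.ext h1 h2)

lemma pair_norm_sq (z : Pair ℝ) : ‖z‖ ^ 2 = z.fst ^ 2 + z.snd ^ 2 := by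
  simp [WithLp.prod_norm_sq_eq_of_L2]

/-- Componentwise pairing of the coordinates of `x₁` and `x₂`, as an isometry on `U × U`. -/
def pairIsometry (Φ : U ≃ₗᵢ[ℝ] SeqL2 ℝ) : Pair U →ₗᵢ[ℝ] SeqL2 (Pair ℝ) where
  toFun x := ⟨fun n => WithLp.toLp 2 (Φ x.fst n, Φ x.snd n), memlp_two_of_summable (by
    simpa [WithLp.prod_norm_sq_eq_of_L2] using
      (summable_norm_sq_coords Φ x.fst).add (summable_norm_sq_coords Φ x.snd))⟩
  map_add' x y := by
    refine lp.ext (funext fun n => pair_ext ?_ ?_)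
    · change Φ (x.fst + y.fst) n = Φ x.fst n + Φ y.fst n
      rw [map_add]; rfl
    · change Φ (x.snd + y.snd) n = Φ x.snd n + Φ y.snd n
      rw [map_add]; rfl
  map_smul' c x := by
    refine lp.ext (funext fun n => pair_ext ?_ ?_)
    · change Φ (c • x.fst) n = c • Φ x.fst n
      rw [map_smul]; rfl
    · change Φ (c • x.snd) n = c • Φ x.snd n
      rw [map_smul]; rfl
  norm_map' x := by
    rw [← sq_eq_sq₀ (norm_nonneg _) (norm_nonneg _), WithLp.prod_norm_sq_eq_of_L2]
    refine (hasSum_norm_sq_coords (LinearIsometryEquiv.refl ℝ (SeqL2 (Pair ℝ))) _).unique ?_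
    simpa [WithLp.prod_norm_sq_eq_of_L2] using
      (hasSum_norm_sq_coords Φ x.fst).add (hasSum_norm_sq_coords Φ x.snd)

lemma pairIsometry_surjective (Φ : U ≃ₗᵢ[ℝ] SeqL2 ℝ) : Function.Surjective (pairIsometry Φ) := by
  intro z
  have hz := summable_norm_sq_coords (LinearIsometryEquiv.refl ℝ (SeqL2 (Pair ℝ))) z
  obtain ⟨x₁, h₁⟩ := exists_coords_eq Φ (z := fun n => (z n).fst)
    (Summable.of_nonneg_of_le (fun n => by positivity) (fun n => by
      simp [WithLp.prod_norm_sq_eq_of_L2, sq_nonneg]) hz)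
  obtain ⟨x₂, h₂⟩ := exists_coords_eq Φ (z := fun n => (z n).snd)
    (Summable.of_nonneg_of_le (fun n => by positivity) (fun n => by
      simp [WithLp.prod_norm_sq_eq_of_L2, sq_nonneg]) hz)
  exact ⟨WithLp.toLp 2 (x₁, x₂), lp.ext (funext fun n => pair_ext (h₁ n) (h₂ n))⟩

/-- The coordinates on `U × U` induced by coordinates on `U`: the `n`-th component of `(x₁, x₂)`
is the pair of the `n`-th coordinates of `x₁` and `x₂`. -/
def pairCoords (Φ : U ≃ₗᵢ[ℝ] SeqL2 ℝ) : Pair U ≃ₗᵢ[ℝ] SeqL2 (Pair ℝ) :=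
  LinearIsometryEquiv.ofSurjective (pairIsometry Φ) (pairIsometry_surjective Φ)

lemma pairCoords_apply (Φ : U ≃ₗᵢ[ℝ] SeqL2 ℝ) (x : Pair U) (n : ℕ) :
    pairCoords Φ x n = WithLp.toLp 2 (Φ x.fst n, Φ x.snd n) := rfl

/-- The matrix `(0, ω; -ω, -a)` of a damped oscillator. -/
def oscillator (ω a : ℝ) : Pair ℝ →L[ℝ] Pair ℝ :=
  LinearMap.toContinuousLinearMap
    { toFun := fun z => WithLp.toLp 2 (ω * z.snd, -(ω * z.fst) - a * z.snd)
      map_add' := fun y z => by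
        exact pair_ext (by simp; ring) (by simp; ring)
      map_smul' := fun c z => by
        exact pair_ext (by simp; ring) (by simp; ring) }

/-- The operator `c ↦ (0, g c)`. -/
def secondInput (g : ℝ) : ℝ →L[ℝ] Pair ℝ :=
  LinearMap.toContinuousLinearMap
    { toFun := fun c => WithLp.toLp 2 (0, g * c)
      map_add' := fun y z => by
        exact pair_ext (by simp) (by simp; ring)
      map_smul' := fun c z => by
        exact pair_ext (by simp) (by simp; ring) }

lemma secondInput_apply (g c : ℝ) : secondInput g c = WithLp.toLp 2 (0, g * c) := rfl

lemma norm_secondInput_apply (g c : ℝ) : ‖secondInput g c‖ = |g| * |c| := by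
  rw [← sq_eq_sq₀ (norm_nonneg _) (by positivity), pair_norm_sq, secondInput_apply]
  simp [mul_pow]

section Operators

variable {Λ : U →ₗ.[ℝ] U} {μ : ℕ → ℝ} {Φ : U ≃ₗᵢ[ℝ] SeqL2 ℝ} {δ : ℝ}

/-- In coordinates the damped operator is the closed block-diagonal operator with blocks
`(0, √μ; -√μ, -ρ μ ^ α)`. -/
lemma mem_graph_dampedOperator
    (hΦ : ∀ (s : ℝ) (x y : U), (x, y) ∈ (fracPow Λ s).graph ↔ ∀ n, Φ y n = μ n ^ s * Φ x n)
    (hδ : 0 < δ) (hμ : ∀ n, δ ≤ μ n) {ρ α : ℝ} (hα : α < 1) (x y : Pair U) :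
    (x, y) ∈ (dampedOperator Λ ρ α).graph ↔
      ∀ n, pairCoords Φ y n =
        oscillator (μ n ^ (1 / 2 : ℝ)) (ρ * μ n ^ α) (pairCoords Φ x n) := by
  have hpos : ∀ n, 0 < μ n := fun n => hδ.trans_le (hμ n)
  have hmul : ∀ n, μ n ^ (1 / 2 : ℝ) * μ n ^ (α - 1 / 2) = μ n ^ α := fun n => by
    rw [← Real.rpow_add (hpos n)]; congr 1; ring
  constructor
  · rw [LinearPMap.mem_graph_iff]
    rintro ⟨⟨x', hx1, hx2, hx3⟩, rfl, rfl⟩ n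
    have h1 := (hΦ (1 / 2) _ _).1 ((fracPow Λ (1 / 2)).mem_graph ⟨x'.snd, hx1⟩) n
    have h2 := (hΦ (α - 1 / 2) _ _).1 ((fracPow Λ (α - 1 / 2)).mem_graph ⟨x'.snd, hx2⟩) n
    have h3 := (hΦ (1 / 2) _ _).1 ((fracPow Λ (1 / 2)).mem_graph ⟨_, hx3⟩) n
    refine pair_ext ?_ ?_
    · exact h1
    · change Φ (-(fracPow Λ (1 / 2)) ⟨_, hx3⟩) n = -(_ * _) - _ * Φ x'.snd n
      rw [map_neg, lp.coeFn_neg, Pi.neg_apply, h3]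
      simp only [map_add, map_smul, lp.coeFn_add, Pi.add_apply, lp.coeFn_smul, Pi.smul_apply, h2,
        smul_eq_mul, ← hmul n, pairCoords_apply, WithLp.toLp_fst]
      ring
  · intro h
    have hy1 : ∀ n, Φ y.fst n = μ n ^ (1 / 2 : ℝ) * Φ x.snd n := fun n =>
      congrArg WithLp.fst (h n)
    have hy2 : ∀ n, Φ y.snd n = -(μ n ^ (1 / 2 : ℝ) * Φ x.fst n) - ρ * μ n ^ α * Φ x.snd n :=
      fun n => congrArg WithLp.snd (h n)
    have g1 := (hΦ (1 / 2) x.snd y.fst).2 hy1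
    -- `Λ ^ (α - 1/2)` is dominated by `Λ ^ (1/2)` because `μ n ≥ δ` and `α < 1`
    obtain ⟨r, hr⟩ : ∃ r : U, ∀ n, Φ r n = μ n ^ (α - 1 / 2) * Φ x.snd n := by
      refine exists_coords_eq Φ (Summable.of_nonneg_of_le (fun n => by positivity) (fun n => ?_)
        ((summable_norm_sq_coords Φ y.fst).mul_left ((δ ^ (α - 1)) ^ 2)))
      rw [← mul_pow]
      refine pow_le_pow_left₀ (norm_nonneg _) ?_ 2
      have e1 : μ n ^ (α - 1 / 2) * Φ x.snd n = μ n ^ (α - 1) * Φ y.fst n := by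
        rw [hy1, ← mul_assoc, ← Real.rpow_add (hpos n)]
        congr 2; ring
      rw [e1, norm_mul, Real.norm_of_nonneg (Real.rpow_nonneg (hpos n).le _)]
      gcongr ?_ * _
      exact Real.rpow_le_rpow_of_nonpos hδ (hμ n) (by linarith)
    have g2 := (hΦ (α - 1 / 2) x.snd r).2 hr
    have g3 := (hΦ (1 / 2) (x.fst + ρ • r) (-y.snd)).2 fun n => by
      simp only [map_add, map_smul, map_neg, lp.coeFn_add, Pi.add_apply, lp.coeFn_smul,
        Pi.smul_apply, lp.coeFn_neg, Pi.neg_apply, hr, hy2, smul_eq_mul, ← hmul n]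
      ring
    rw [LinearPMap.mem_graph_iff] at g1 g2 g3
    obtain ⟨⟨u1, d1⟩, rfl, e1⟩ := g1
    obtain ⟨⟨u2, d2⟩, e2', e2⟩ := g2
    obtain ⟨⟨u3, d3⟩, e3', e3⟩ := g3
    dsimp only at e2' e3' e1 e2 e3
    subst e2' e3'
    subst e2
    rw [LinearPMap.mem_graph_iff]
    refine ⟨⟨x, d1, d2, d3⟩, rfl, pair_ext e1 ?_⟩
    change -(fracPow Λ (1 / 2)) ⟨_, d3⟩ = y.snd
    rw [e3, neg_neg]

lemma isBlockDiag_inputOperator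
    (hΦ : ∀ (s : ℝ) (x y : U), (x, y) ∈ (fracPow Λ s).graph ↔ ∀ n, Φ y n = μ n ^ s * Φ x n)
    (hδ : 0 < δ) (hμ : ∀ n, δ ≤ μ n) {s : ℝ} (hs : 0 ≤ s) :
    IsBlockDiag Φ (pairCoords Φ) (inputOperator Λ s) (fun n => secondInput (μ n ^ (-s))) := by
  have hpos : ∀ n, 0 < μ n := fun n => hδ.trans_le (hμ n)
  have hex : ∃ L : U →L[ℝ] U, ∀ x : U, (x, L x) ∈ (fracPow Λ (-s)).graph := by
    obtain ⟨L, hL⟩ := exists_isBlockDiag Φ Φ (C := δ ^ (-s))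
      (fun n => (μ n ^ (-s)) • ContinuousLinearMap.id ℝ ℝ) fun n z => by
        simp only [_root_.smul_apply, ContinuousLinearMap.id_apply, norm_smul]
        gcongr ?_ * _
        rw [Real.norm_of_nonneg (Real.rpow_nonneg (hpos n).le _)]
        exact Real.rpow_le_rpow_of_nonpos hδ (hμ n) (by linarith)
    exact ⟨L, fun x => (hΦ _ _ _).2 fun n => by rw [hL]; simp⟩
  intro v n
  have hv : (v, toBounded (fracPow Λ (-s)) v) ∈ (fracPow Λ (-s)).graph := by
    rw [toBounded, dif_pos hex]
    exact hex.choose_spec v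
  refine pair_ext ?_ ?_
  · change Φ 0 n = 0
    simp
  · exact (hΦ _ _ _).1 hv n

end Operators
end Spectral

/-! ### The damped oscillator: flow, energy decay and steering to rest -/

section Exponential

variable {E : Type*} [NormedAddCommGroup E] [NormedSpace ℝ E] (M : E →L[ℝ] E)

/-- The flow `exp (s M)` of the linear equation `z' = M z`. -/
def expFlow (s : ℝ) : E →L[ℝ] E := NormedSpace.exp (s • M)

lemma expFlow_zero : expFlow M 0 = ContinuousLinearMap.id ℝ E := by
  rw [expFlow, zero_smul, NormedSpace.exp_zero]; rfl

variable [CompleteSpace E]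

lemma expFlow_add (s t : ℝ) : expFlow M (s + t) = expFlow M s ∘L expFlow M t := by
  let _ : NormedAlgebra ℚ (E →L[ℝ] E) := NormedAlgebra.restrictScalars ℚ ℝ _
  rw [expFlow, add_smul, NormedSpace.exp_add_of_commute]
  · rfl
  · exact ((Commute.refl _).smul_left s).smul_right t

lemma hasDerivAt_expFlow (s : ℝ) : HasDerivAt (expFlow M) (expFlow M s ∘L M) s :=
  hasDerivAt_exp_smul_const (𝕂 := ℝ) M s

lemma continuous_expFlow : Continuous (expFlow M) :=
  continuous_iff_continuousAt.2 fun s => (hasDerivAt_expFlow M s).continuousAt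

lemma hasDerivAt_expFlow_apply (s : ℝ) (z : E) :
    HasDerivAt (fun s => expFlow M s z) (M (expFlow M s z)) s := by
  have h : HasDerivAt (expFlow M) (M ∘L expFlow M s) s :=
    hasDerivAt_exp_smul_const' (𝕂 := ℝ) M s
  simpa using h.clm_apply (hasDerivAt_const s z)

/-- Differentiation of the flow run backwards from time `t` along a curve. -/
lemma hasDerivAt_expFlow_sub_apply {X : ℝ → E} {w : E} {t s : ℝ}
    (hX : HasDerivAt X (M (X s) + w) s) :
    HasDerivAt (fun s => expFlow M (t - s) (X s)) (expFlow M (t - s) w) s := by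
  have h1 : HasDerivAt (fun s => expFlow M (t - s)) (-(expFlow M (t - s) ∘L M)) s := by
    have := (hasDerivAt_expFlow M (t - s)).scomp s ((hasDerivAt_id s).const_sub t)
    simpa [Function.comp_def] using this
  refine (h1.clm_apply hX).congr_deriv ?_
  simp

lemma intervalIntegrable_expFlow_sub {w : ℝ → E} (hw : Continuous w) (t : ℝ) :
    IntervalIntegrable (fun s => expFlow M (t - s) (w s)) volume 0 t :=
  (((continuous_expFlow M).comp (by fun_prop)).clm_apply hw).intervalIntegrable _ _

end Exponential

section Oscillator

/-- The flow of the damped oscillator `(0, ω; -ω, -a)`. -/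
def flow (ω a s : ℝ) : Pair ℝ →L[ℝ] Pair ℝ := expFlow (oscillator ω a) s

variable (ω a : ℝ)

lemma flow_zero_apply (z : Pair ℝ) : flow ω a 0 z = z := by
  rw [flow, expFlow_zero]; rfl

lemma flow_add_apply (s t : ℝ) (z : Pair ℝ) :
    flow ω a (s + t) z = flow ω a s (flow ω a t z) := by
  rw [flow, expFlow_add]; rfl

lemma continuous_flow : Continuous (flow ω a) := continuous_expFlow _

lemma hasDerivAt_flow_apply (s : ℝ) (z : Pair ℝ) :
    HasDerivAt (fun s => flow ω a s z) (oscillator ω a (flow ω a s z)) s :=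
  hasDerivAt_expFlow_apply _ s z

lemma hasDerivAt_flow_fst (s : ℝ) (z : Pair ℝ) :
    HasDerivAt (fun s => (flow ω a s z).fst) (ω * (flow ω a s z).snd) s :=
  (WithLp.fstL 2 ℝ ℝ ℝ).hasFDerivAt.comp_hasDerivAt s (hasDerivAt_flow_apply ω a s z)

lemma hasDerivAt_flow_snd (s : ℝ) (z : Pair ℝ) :
    HasDerivAt (fun s => (flow ω a s z).snd)
      (-(ω * (flow ω a s z).fst) - a * (flow ω a s z).snd) s :=
  (WithLp.sndL 2 ℝ ℝ ℝ).hasFDerivAt.comp_hasDerivAt s (hasDerivAt_flow_apply ω a s z)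

variable {ω a}

lemma abs_snd_le (z : Pair ℝ) : |z.snd| ≤ ‖z‖ :=
  abs_le_of_sq_le_sq (by rw [pair_norm_sq]; linarith [sq_nonneg z.fst]) (norm_nonneg _)

lemma norm_flow_apply_le (ha : 0 ≤ a) {s : ℝ} (hs : 0 ≤ s) (z : Pair ℝ) :
    ‖flow ω a s z‖ ≤ ‖z‖ := by
  have hanti : Antitone fun s => (flow ω a s z).fst ^ 2 + (flow ω a s z).snd ^ 2 := by
    refine antitone_of_hasDerivAt_nonpos (fun s =>
      ((hasDerivAt_flow_fst ω a s z).pow 2).add ((hasDerivAt_flow_snd ω a s z).pow 2)) fun s => ?_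
    simp only [Pi.zero_apply]
    norm_num
    nlinarith [mul_nonneg ha (sq_nonneg (flow ω a s z).snd)]
  have h := hanti hs
  simp only [← pair_norm_sq, flow_zero_apply] at h
  exact le_of_sq_le_sq h (norm_nonneg _)

/-- The Lyapunov function of the damped oscillator: the mechanical energy `z₁² + z₂²` plus the
energy `z₁² + (z₂ + d z₁)²` of the dual first-order form, where `d = a / ω`. The first loses
`2 a z₂²` per unit of time and the second `2 a z₁²`, so that the sum decays exponentially in the
underdamped as well as in the overdamped regime. -/
def energy (d : ℝ) (z : Pair ℝ) : ℝ := 2 * z.fst ^ 2 + z.snd ^ 2 + (z.snd + d * z.fst) ^ 2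

/-- The exponential decay rate of `energy` along the flow. -/
def decayRate (a d : ℝ) : ℝ := 2 * a / (3 + 2 * d ^ 2)

lemma energy_le (d : ℝ) (z : Pair ℝ) : energy d z ≤ (3 + 2 * d ^ 2) * ‖z‖ ^ 2 := by
  rw [pair_norm_sq, energy]
  nlinarith [sq_nonneg (z.snd - d * z.fst), sq_nonneg (d * z.snd), sq_nonneg z.fst]

lemma energy_flow_le {d : ℝ} (hd : d * ω = a) (ha : 0 ≤ a) {s : ℝ} (hs : 0 ≤ s) (z : Pair ℝ) :
    energy d (flow ω a s z) ≤ Real.exp (-(decayRate a d * s)) * energy d z := by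
  set κ := decayRate a d
  have hderiv : ∀ s, HasDerivAt (fun s => energy d (flow ω a s z))
      (-2 * a * ((flow ω a s z).fst ^ 2 + (flow ω a s z).snd ^ 2)) s := fun s => by
    have h1 := hasDerivAt_flow_fst ω a s z
    have h2 := hasDerivAt_flow_snd ω a s z
    have h := (((h1.pow 2).const_mul 2).add (h2.pow 2)).add ((h2.add (h1.const_mul d)).pow 2)
    refine h.congr_deriv ?_
    simp only [Pi.add_apply]
    rw [← hd]
    norm_num
    ring
  have hle : ∀ p : Pair ℝ, κ * energy d p ≤ 2 * a * (p.fst ^ 2 + p.snd ^ 2) := fun p => by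
    rw [← pair_norm_sq]
    calc κ * energy d p ≤ κ * ((3 + 2 * d ^ 2) * ‖p‖ ^ 2) := by
          gcongr
          · exact div_nonneg (by linarith) (by positivity)
          · exact energy_le d p
      _ = 2 * a * ‖p‖ ^ 2 := by
          have : 3 + 2 * d ^ 2 ≠ 0 := by positivity
          simp only [κ, decayRate]
          field_simp
  have hanti : Antitone fun s => Real.exp (κ * s) * energy d (flow ω a s z) := by
    refine antitone_of_hasDerivAt_nonpos (fun s =>
      (((hasDerivAt_id s).const_mul κ).exp).mul (hderiv s)) fun s => ?_
    have := mul_nonneg (Real.exp_nonneg (κ * s)) (sub_nonneg.2 (hle (flow ω a s z)))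
    simp only [id, Pi.zero_apply]
    linarith
  have h := hanti hs
  simp only [mul_zero, Real.exp_zero, one_mul, flow_zero_apply] at h
  rw [Real.exp_neg, ← div_eq_inv_mul, le_div_iff₀ (Real.exp_pos _), mul_comm]
  exact h

lemma abs_flow_fst_le (hω : 0 ≤ ω) (ha : 0 ≤ a) {s : ℝ} (hs : 0 ≤ s) {z : Pair ℝ}
    (hz : z.fst = 0) : |(flow ω a s z).fst| ≤ ω * s * ‖z‖ := by
  have h := norm_image_sub_le_of_norm_deriv_le_segment' (f := fun s => (flow ω a s z).fst)
    (C := ω * ‖z‖) (fun x _ => (hasDerivAt_flow_fst ω a x z).hasDerivWithinAt)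
    (fun x hx => by
      rw [norm_mul, Real.norm_of_nonneg hω]
      gcongr
      exact (abs_snd_le _).trans (norm_flow_apply_le ha hx.1 z)) s (right_mem_Icc.2 hs)
  simp only [flow_zero_apply, hz, sub_zero, Real.norm_eq_abs] at h
  linarith

/-- `χ`, with derivatives `χ₁` and `χ₂`, is a cutoff in time on `[0, t]`: it descends from `1`
to `0`, is constant on the first half, and its derivatives scale like `t⁻¹` and `t⁻²`. -/
structure IsCutoff (C t : ℝ) (χ χ₁ χ₂ : ℝ → ℝ) : Prop where
  hasDerivAt : ∀ s, HasDerivAt χ (χ₁ s) s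
  hasDerivAt' : ∀ s, HasDerivAt χ₁ (χ₂ s) s
  continuous : Continuous χ₂
  zero : χ 0 = 1
  zero' : χ₁ 0 = 0
  final : χ t = 0
  final' : χ₁ t = 0
  first_half : ∀ s, s < t / 2 → χ₁ s = 0 ∧ χ₂ s = 0
  bound : ∀ s ∈ Icc 0 t, |χ₁ s| ≤ C / t
  bound' : ∀ s ∈ Icc 0 t, |χ₂ s| ≤ C / t ^ 2

lemma exists_isCutoff : ∃ C : ℝ, 0 < C ∧ ∀ t : ℝ, 0 < t → ∃ χ χ₁ χ₂, IsCutoff C t χ χ₁ χ₂ := by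
  set σ := Real.smoothTransition
  have hσ : ContDiff ℝ 2 σ := Real.smoothTransition.contDiff
  have hσ' : ContDiff ℝ 1 (deriv σ) :=
    ((contDiff_succ_iff_deriv (n := 1)).1 hσ).2.2
  have hσ'' : Continuous (deriv (deriv σ)) := hσ'.continuous_deriv le_rfl
  have hd : ∀ x, HasDerivAt σ (deriv σ x) x := fun x =>
    (hσ.differentiable (by norm_num) x).hasDerivAt
  have hd' : ∀ x, HasDerivAt (deriv σ) (deriv (deriv σ) x) x := fun x =>
    (hσ'.differentiable (by norm_num) x).hasDerivAt
  have hev : ∀ x : ℝ, 1 < x → σ =ᶠ[𝓝 x] fun _ => 1 := fun x hx => by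
    filter_upwards [lt_mem_nhds hx] with y hy
    exact Real.smoothTransition.one_of_one_le hy.le
  have hev' : ∀ x : ℝ, 1 < x → deriv σ =ᶠ[𝓝 x] fun _ => 0 := fun x hx => by
    simpa using (hev x hx).deriv
  have h0 : deriv σ 0 = 0 := by
    refine IsLocalMin.deriv_eq_zero (Filter.Eventually.of_forall fun y => ?_)
    rw [show σ 0 = 0 from Real.smoothTransition.zero]
    exact Real.smoothTransition.nonneg y
  obtain ⟨C₁, hC₁⟩ := (isCompact_Icc (a := (0 : ℝ)) (b := 2)).exists_bound_of_continuousOn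
    (hσ'.continuous.continuousOn)
  obtain ⟨C₂, hC₂⟩ := (isCompact_Icc (a := (0 : ℝ)) (b := 2)).exists_bound_of_continuousOn
    (hσ''.continuousOn)
  refine ⟨2 * |C₁| + 4 * |C₂| + 1, by positivity, fun t ht => ?_⟩
  have hin : ∀ s, HasDerivAt (fun s => 2 - 2 / t * s) (-(2 / t)) s := fun s => by
    simpa using ((hasDerivAt_id s).const_mul (2 / t)).const_sub 2
  have ht2 : 2 / t * t = 2 := by field_simp
  have hmem : ∀ s ∈ Icc 0 t, 2 - 2 / t * s ∈ Icc (0 : ℝ) 2 := fun s hs => by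
    constructor
    · have : 2 / t * s ≤ 2 / t * t := by gcongr; exact hs.2
      linarith
    · have : 0 ≤ 2 / t * s := mul_nonneg (by positivity) hs.1
      linarith
  have h2 : deriv σ 2 = 0 := (hev' 2 (by norm_num)).eq_of_nhds
  refine ⟨fun s => σ (2 - 2 / t * s), fun s => -(2 / t) * deriv σ (2 - 2 / t * s),
    fun s => (2 / t) ^ 2 * deriv (deriv σ) (2 - 2 / t * s), ⟨fun s => ?_, fun s => ?_, ?_, ?_, ?_,
      ?_, ?_, fun s hs => ?_, fun s hs => ?_, fun s hs => ?_⟩⟩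
  · exact ((hd _).comp s (hin s)).congr_deriv (by ring)
  · exact (((hd' _).comp s (hin s)).const_mul _).congr_deriv (by ring)
  · exact continuous_const.mul (hσ''.comp (by fun_prop))
  · rw [mul_zero, sub_zero]
    exact Real.smoothTransition.one_of_one_le (by norm_num)
  · simp [h2]
  · rw [ht2, sub_self]
    exact Real.smoothTransition.zero
  · simp [ht2, h0]
  · have hx : 1 < 2 - 2 / t * s := by
      have : 2 / t * s < 2 / t * (t / 2) := by gcongr
      have e : 2 / t * (t / 2) = 1 := by field_simp
      linarith
    have e1 := (hev' _ hx).eq_of_nhds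
    have e2 := (hev' _ hx).deriv_eq
    simp only [deriv_const] at e2
    simp [e1, e2]
  · have h := (hC₁ _ (hmem s hs)).trans (le_abs_self C₁)
    rw [Real.norm_eq_abs] at h
    rw [abs_mul, abs_neg, abs_of_pos (by positivity : 0 < 2 / t), div_mul_eq_mul_div]
    gcongr
    linarith [abs_nonneg C₂]
  · have h := (hC₂ _ (hmem s hs)).trans (le_abs_self C₂)
    rw [Real.norm_eq_abs] at h
    rw [abs_mul, abs_of_pos (by positivity : 0 < (2 / t) ^ 2), div_pow, div_mul_eq_mul_div]
    gcongr
    linarith [abs_nonneg C₁]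

/-- The force that drives the damped oscillator along `χ` times a free trajectory: `c₁`, `c₂` are
the values of `χ'`, `χ''` and `p` is the position of the free trajectory. -/
def steering (ω d c₁ c₂ : ℝ) (p : Pair ℝ) : ℝ := 2 * c₁ * p.snd + c₂ * p.fst / ω + d * c₁ * p.fst

lemma hasDerivAt_toLp {f g : ℝ → ℝ} {f' g' s : ℝ} (hf : HasDerivAt f f' s)
    (hg : HasDerivAt g g' s) :
    HasDerivAt (fun s => (WithLp.toLp 2 (f s, g s) : Pair ℝ)) (WithLp.toLp 2 (f', g')) s :=
  ((WithLp.prodContinuousLinearEquiv 2 ℝ ℝ ℝ).symm : ℝ × ℝ →L[ℝ] Pair ℝ).hasFDerivAt.comp_hasDerivAt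
    s (hf.prodMk hg)

lemma continuous_steering {χ₁ χ₂ : ℝ → ℝ} (h₁ : Continuous χ₁) (h₂ : Continuous χ₂)
    (d : ℝ) (z : Pair ℝ) :
    Continuous fun s => steering ω d (χ₁ s) (χ₂ s) (flow ω a s z) := by
  have hf : Continuous fun s => (flow ω a s z).fst :=
    continuous_iff_continuousAt.2 fun s => (hasDerivAt_flow_fst ω a s z).continuousAt
  have hs : Continuous fun s => (flow ω a s z).snd :=
    continuous_iff_continuousAt.2 fun s => (hasDerivAt_flow_snd ω a s z).continuousAt
  unfold steering
  fun_prop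

lemma IsCutoff.continuous' {C t : ℝ} {χ χ₁ χ₂ : ℝ → ℝ} (h : IsCutoff C t χ χ₁ χ₂) :
    Continuous χ₁ :=
  continuous_iff_continuousAt.2 fun s => (h.hasDerivAt' s).continuousAt

/-- The state `(χ h₁, χ h₂ + χ' h₁ / ω)`, for a free trajectory `(h₁, h₂)`, solves the equation
forced by `steering` and comes to rest at time `t`. -/
lemma flow_add_integral_steering {d C t : ℝ} {χ χ₁ χ₂ : ℝ → ℝ} (h : IsCutoff C t χ χ₁ χ₂)
    (hω : 0 < ω) (hd : d * ω = a) (z : Pair ℝ) {g : ℝ} {u : ℝ → ℝ}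
    (hu : ∀ s, g * u s = steering ω d (χ₁ s) (χ₂ s) (flow ω a s z)) :
    flow ω a t z + ∫ s in (0 : ℝ)..t, flow ω a (t - s) (secondInput g (u s)) = 0 := by
  subst hd
  set X : ℝ → Pair ℝ := fun s => WithLp.toLp 2 (χ s * (flow ω (d * ω) s z).fst,
    χ s * (flow ω (d * ω) s z).snd + χ₁ s * (flow ω (d * ω) s z).fst / ω)
  set w : ℝ → Pair ℝ := fun s => secondInput g (u s)
  have hw : Continuous w := by
    have e : w = fun s => secondInput 1 (steering ω d (χ₁ s) (χ₂ s) (flow ω (d * ω) s z)) := by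
      funext s
      simp only [w, secondInput_apply, hu, one_mul]
    rw [e]
    exact (secondInput 1).continuous.comp (continuous_steering h.continuous' h.continuous d z)
  have hX : ∀ s, HasDerivAt X (oscillator ω (d * ω) (X s) + w s) s := fun s => by
    have h1 := hasDerivAt_flow_fst ω (d * ω) s z
    have h2 := hasDerivAt_flow_snd ω (d * ω) s z
    refine (hasDerivAt_toLp ((h.hasDerivAt s).mul h1)
      (((h.hasDerivAt s).mul h2).add (((h.hasDerivAt' s).mul h1).div_const ω))).congr_deriv
        (pair_ext ?_ ?_)
    · rw [WithLp.toLp_fst]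
      change _ = ω * (χ s * (flow ω (d * ω) s z).snd + χ₁ s * (flow ω (d * ω) s z).fst / ω) + 0
      field_simp
      ring
    · rw [WithLp.toLp_snd]
      change _ = -(ω * (χ s * (flow ω (d * ω) s z).fst)) -
        d * ω * (χ s * (flow ω (d * ω) s z).snd + χ₁ s * (flow ω (d * ω) s z).fst / ω) + g * u s
      rw [hu, steering]
      field_simp
      ring
  have hY : ∀ s, HasDerivAt (fun s => flow ω (d * ω) (t - s) (X s)) (flow ω (d * ω) (t - s) (w s)) s :=
    fun s => hasDerivAt_expFlow_sub_apply (oscillator ω (d * ω)) (hX s)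
  have hint := intervalIntegral.integral_eq_sub_of_hasDerivAt (a := 0) (b := t) (fun s _ => hY s)
    (intervalIntegrable_expFlow_sub (oscillator ω (d * ω)) hw t)
  have hX0 : X 0 = z := by
    refine pair_ext ?_ ?_ <;> simp [X, h.zero, h.zero', flow_zero_apply]
  have hXt : X t = 0 := by
    refine pair_ext ?_ ?_ <;> simp [X, h.final, h.final']
  rw [hint, hX0, hXt]
  simp

lemma abs_steering_le {d C t B c₁ c₂ : ℝ} (hω : 0 < ω) (hd : 0 ≤ d) (ht : 0 < t)
    (hc₁ : |c₁| ≤ C / t) (hc₂ : |c₂| ≤ C / t ^ 2) (hB : 0 ≤ B) {p : Pair ℝ}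
    (hp : energy d p ≤ B ^ 2) :
    |steering ω d c₁ c₂ p| ≤ C / t * (4 * B + |p.fst| / (ω * t)) ∧ d * |p.fst| ≤ 2 * B := by
  have h2 : |p.snd| ≤ B := abs_le_of_sq_le_sq (by
    unfold energy at hp
    nlinarith [sq_nonneg p.fst, sq_nonneg (p.snd + d * p.fst)]) hB
  have h3 : |p.snd + d * p.fst| ≤ B := abs_le_of_sq_le_sq (by
    unfold energy at hp
    nlinarith [sq_nonneg p.fst, sq_nonneg p.snd]) hB
  have h1 : d * |p.fst| ≤ 2 * B := by
    calc d * |p.fst| = |(p.snd + d * p.fst) - p.snd| := by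
          rw [add_sub_cancel_left, abs_mul, abs_of_nonneg hd]
      _ ≤ |p.snd + d * p.fst| + |p.snd| := abs_sub _ _
      _ ≤ 2 * B := by linarith
  refine ⟨?_, h1⟩
  have hC : 0 ≤ C / t := (abs_nonneg _).trans hc₁
  calc |steering ω d c₁ c₂ p|
      ≤ |2 * c₁ * p.snd| + |c₂ * p.fst / ω| + |d * c₁ * p.fst| := abs_add_three _ _ _
    _ = 2 * (|c₁| * |p.snd|) + |c₂| * (|p.fst| / ω) + |c₁| * (d * |p.fst|) := by
        rw [abs_mul, abs_mul, abs_div, abs_mul, abs_mul, abs_mul, abs_of_pos hω, abs_of_nonneg hd,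
          abs_of_pos (two_pos)]
        ring
    _ ≤ 2 * (C / t * B) + C / t ^ 2 * (|p.fst| / ω) + C / t * (2 * B) := by gcongr
    _ = C / t * (4 * B + |p.fst| / (ω * t)) := by
        field_simp
        ring

end Oscillator

/-! ### Bounds for the steering force that are uniform over the modes -/

section Bounds

lemma rpow_mul_exp_neg_le {p c x : ℝ} (hp : 0 ≤ p) (hc : 0 < c) (hx : 0 ≤ x) :
    x ^ p * Real.exp (-(c * x)) ≤ (p / c) ^ p := by
  rcases hp.eq_or_lt with rfl | hp
  · simpa using mul_nonneg hc.le hx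
  have h1 : c * x / p ≤ Real.exp (c * x / p) := by linarith [Real.add_one_le_exp (c * x / p)]
  have h2 : (c * x / p) ^ p ≤ Real.exp (c * x) := by
    calc (c * x / p) ^ p ≤ Real.exp (c * x / p) ^ p :=
          Real.rpow_le_rpow (by positivity) h1 hp.le
      _ = Real.exp (c * x) := by rw [← Real.exp_mul, div_mul_cancel₀ _ hp.ne']
  have h3 : x ^ p = (p / c) ^ p * (c * x / p) ^ p := by
    rw [← Real.mul_rpow (by positivity) (by positivity)]
    congr 1
    field_simp
  rw [h3, mul_assoc]
  refine mul_le_of_le_one_right (by positivity) ?_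
  rw [Real.exp_neg, ← div_eq_mul_inv]
  exact (div_le_one (Real.exp_pos _)).2 h2

lemma rpow_le_mul_rpow {δ m p q : ℝ} (hδ : 0 < δ) (hm : δ ≤ m) (hpq : p ≤ q) :
    m ^ p ≤ δ ^ (p - q) * m ^ q := by
  have hm0 : 0 < m := hδ.trans_le hm
  calc m ^ p = m ^ (p - q) * m ^ q := by rw [← Real.rpow_add hm0]; congr 1; ring
    _ ≤ δ ^ (p - q) * m ^ q := by
      exact mul_le_mul_of_nonneg_right
        (Real.rpow_le_rpow_of_nonpos hδ hm (by linarith)) (by positivity)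

/-- The weight `3 + 2 d²` in `energy_le`, for `d = ρ m ^ (α - 1/2)`. -/
lemma exists_weight_le {δ ρ α r : ℝ} (hδ : 0 < δ) (hr : r ≤ α) (hr' : r ≤ 1 - α) :
    ∃ C : ℝ, 0 < C ∧ ∀ m, δ ≤ m → 3 + 2 * (ρ * m ^ (α - 1 / 2)) ^ 2 ≤ C * m ^ (α - r) := by
  refine ⟨3 * δ ^ (0 - (α - r)) + 2 * ρ ^ 2 * δ ^ ((2 * α - 1) - (α - r)), by positivity,
    fun m hm => ?_⟩
  have hm0 : 0 < m := hδ.trans_le hm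
  have h1 := rpow_le_mul_rpow (p := 0) (q := α - r) hδ hm (by linarith)
  have h2 := rpow_le_mul_rpow (p := 2 * α - 1) (q := α - r) hδ hm (by linarith)
  have h3 : (m ^ (α - 1 / 2)) ^ 2 = m ^ (2 * α - 1) := by
    rw [← Real.rpow_natCast, ← Real.rpow_mul hm0.le]
    congr 1; push_cast; ring
  rw [Real.rpow_zero] at h1
  rw [mul_pow, h3]
  calc 3 + 2 * (ρ ^ 2 * m ^ (2 * α - 1)) = 3 * 1 + 2 * ρ ^ 2 * m ^ (2 * α - 1) := by ring
    _ ≤ 3 * (δ ^ (0 - (α - r)) * m ^ (α - r)) +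
        2 * ρ ^ 2 * (δ ^ ((2 * α - 1) - (α - r)) * m ^ (α - r)) := by gcongr
    _ = _ := by ring

/-- The slowest decay in the mode with eigenvalue `m` is of order `m ^ r`,
`r = min (α, 1 - α)`. -/
lemma exists_le_decayRate {δ ρ α r : ℝ} (hδ : 0 < δ) (hρ : 0 < ρ) (hr : r ≤ α)
    (hr' : r ≤ 1 - α) :
    ∃ k : ℝ, 0 < k ∧ ∀ m, δ ≤ m → k * m ^ r ≤ decayRate (ρ * m ^ α) (ρ * m ^ (α - 1 / 2)) := by
  obtain ⟨C, hC, hw⟩ := exists_weight_le (ρ := ρ) hδ hr hr'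
  refine ⟨2 * ρ / C, by positivity, fun m hm => ?_⟩
  have hm0 : 0 < m := hδ.trans_le hm
  have e : m ^ r * m ^ (α - r) = m ^ α := by rw [← Real.rpow_add hm0]; congr 1; ring
  rw [decayRate, le_div_iff₀ (by positivity)]
  calc 2 * ρ / C * m ^ r * (3 + 2 * (ρ * m ^ (α - 1 / 2)) ^ 2)
      ≤ 2 * ρ / C * m ^ r * (C * m ^ (α - r)) := by gcongr; exact hw m hm
    _ = 2 * ρ * (m ^ r * m ^ (α - r)) := by field_simp
    _ = 2 * (ρ * m ^ α) := by rw [e]; ring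

lemma energy_flow_le_sq {ω a d t s b κ : ℝ} (hd : d * ω = a) (ha : 0 ≤ a) (hκ : 0 ≤ κ)
    (hκ' : κ ≤ decayRate a d) (hs : 0 ≤ s) (hst : t / 2 ≤ s) {z : Pair ℝ}
    (hz : energy d z ≤ b ^ 2) :
    energy d (flow ω a s z) ≤ (b * Real.exp (-(κ / 4 * t))) ^ 2 := by
  refine (energy_flow_le hd ha hs z).trans ?_
  rw [mul_pow, ← Real.exp_nat_mul, mul_comm]
  refine mul_le_mul (hz) (Real.exp_le_exp.2 ?_) (Real.exp_nonneg _) (sq_nonneg b)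
  have h1 : κ * (t / 2) ≤ κ * s := mul_le_mul_of_nonneg_left hst hκ
  have h2 : κ * s ≤ decayRate a d * s := mul_le_mul_of_nonneg_right hκ' hs
  push_cast
  linarith

/-- For an initial state `(0, v)` the force is of size `t⁻¹` and inherits the decay of the
free trajectory. The displacement contributes `|h₁| / (ω t)`; it is bounded by the decayed energy
over `a t` if `m ^ r t > 1`, and by `‖v‖` otherwise, as it starts from zero. -/
lemma exists_steering_le {δ ρ α r C : ℝ} (hδ : 0 < δ) (hρ : 0 < ρ) (hr : r ≤ α)
    (hr' : r ≤ 1 - α) (hC : 0 < C) :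
    ∃ K c : ℝ, 0 < K ∧ 0 < c ∧ ∀ m, δ ≤ m → ∀ t, 0 < t → ∀ χ χ₁ χ₂, IsCutoff C t χ χ₁ χ₂ →
      ∀ s ∈ Icc 0 t, ∀ z : Pair ℝ, z.fst = 0 →
        |steering (m ^ (1 / 2 : ℝ)) (ρ * m ^ (α - 1 / 2)) (χ₁ s) (χ₂ s)
          (flow (m ^ (1 / 2 : ℝ)) (ρ * m ^ α) s z)| ≤
            K / t * Real.exp (-(c * (m ^ r * t))) * ‖z‖ := by
  obtain ⟨k, hk, hdecay⟩ := exists_le_decayRate hδ hρ hr hr'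
  set A := δ ^ (r - α) / ρ
  have hA : 0 < A := by positivity
  refine ⟨C * (8 + 4 * A + Real.exp (k / 4)), k / 4, by positivity, by positivity,
    fun m hm t ht χ χ₁ χ₂ hχ s hs z hz => ?_⟩
  have hm0 : 0 < m := hδ.trans_le hm
  rcases lt_or_ge s (t / 2) with hst | hst
  · obtain ⟨e1, e2⟩ := hχ.first_half s hst
    rw [e1, e2]
    simp only [steering, mul_zero, zero_mul, zero_div, add_zero, abs_zero]
    positivity
  set ω := m ^ (1 / 2 : ℝ)
  set d := ρ * m ^ (α - 1 / 2)
  set a := ρ * m ^ α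
  have hω : 0 < ω := by positivity
  have hd0 : 0 < d := by positivity
  have ha : 0 < a := by positivity
  have hd : d * ω = a := by
    simp only [d, ω, a]
    rw [mul_assoc, ← Real.rpow_add hm0]; congr 2; ring
  set ε := Real.exp (-(k / 4 * (m ^ r * t)))
  have hε : 0 < ε := Real.exp_pos _
  have hE : energy d (flow ω a s z) ≤ (2 * ‖z‖ * ε) ^ 2 := by
    have h := energy_flow_le_sq (κ := k * m ^ r) (b := 2 * ‖z‖) hd ha.le (by positivity)
      (hdecay m hm) hs.1 hst (z := z) (by
        rw [mul_pow, pair_norm_sq, energy, hz]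
        nlinarith [sq_nonneg z.snd])
    rwa [show k * m ^ r / 4 * t = k / 4 * (m ^ r * t) by ring] at h
  obtain ⟨h1, h2⟩ := abs_steering_le hω hd0.le ht (hχ.bound s hs) (hχ.bound' s hs)
    (by positivity) hE
  set p := flow ω a s z
  have h3 : |p.fst| / (ω * t) ≤ (4 * A + Real.exp (k / 4)) * ‖z‖ * ε := by
    rcases le_or_gt (m ^ r * t) 1 with hx | hx
    · have h4 : |p.fst| / (ω * t) ≤ ‖z‖ := by
        rw [div_le_iff₀ (by positivity)]
        calc |p.fst| ≤ ω * s * ‖z‖ := abs_flow_fst_le hω.le ha.le hs.1 hz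
          _ ≤ ω * t * ‖z‖ := by gcongr; exact hs.2
          _ = ‖z‖ * (ω * t) := by ring
      have h5 : 1 ≤ Real.exp (k / 4) * ε := by
        rw [← Real.exp_add]
        refine Real.one_le_exp ?_
        nlinarith
      calc |p.fst| / (ω * t) ≤ ‖z‖ * 1 := by rwa [mul_one]
        _ ≤ ‖z‖ * (Real.exp (k / 4) * ε) := by gcongr
        _ = Real.exp (k / 4) * ‖z‖ * ε := by ring
        _ ≤ _ := by gcongr; linarith
    · have h4 : 1 ≤ A * (a * t) := by
        have h := rpow_le_mul_rpow hδ hm hr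
        calc 1 ≤ m ^ r * t := hx.le
          _ ≤ δ ^ (r - α) * m ^ α * t := by gcongr
          _ = A * (a * t) := by simp only [A, a]; field_simp
      rw [div_le_iff₀ (by positivity)]
      have h5 : d * |p.fst| ≤ d * ((4 * A + Real.exp (k / 4)) * ‖z‖ * ε * (ω * t)) := by
        calc d * |p.fst| ≤ 2 * (2 * ‖z‖ * ε) * 1 := by linarith
          _ ≤ 2 * (2 * ‖z‖ * ε) * (A * (a * t)) := by gcongr
          _ = (4 * A) * ‖z‖ * ε * (a * t) := by ring
          _ ≤ (4 * A + Real.exp (k / 4)) * ‖z‖ * ε * (a * t) := by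
            gcongr; linarith [Real.exp_pos (k / 4)]
          _ = _ := by rw [← hd]; ring
      exact le_of_mul_le_mul_left h5 hd0
  calc _ ≤ C / t * (4 * (2 * ‖z‖ * ε) + |p.fst| / (ω * t)) := h1
    _ ≤ C / t * (4 * (2 * ‖z‖ * ε) + (4 * A + Real.exp (k / 4)) * ‖z‖ * ε) := by gcongr
    _ = _ := by ring

/-- The powers of the eigenvalue brought in by the operators `Λ ^ γ` and `Λ ^ (-β)` are absorbed
by the exponential decay, at the price of a power of `t`. -/
lemma exists_rpow_mul_exp_le {δ r c q : ℝ} (hδ : 0 < δ) (hr : 0 < r) (hc : 0 < c) :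
    ∃ K : ℝ, 0 < K ∧ ∀ m, δ ≤ m → ∀ t, 0 < t →
      m ^ q * Real.exp (-(c * (m ^ r * t))) ≤ K / t ^ max (q / r) 0 := by
  set p := max (q / r) 0
  have hp : 0 ≤ p := le_max_right _ _
  have hqp : q ≤ r * p := by
    have : q / r ≤ p := le_max_left _ _
    rwa [div_le_iff₀ hr, mul_comm] at this
  refine ⟨δ ^ (q - r * p) * ((p / c) ^ p + 1), by positivity, fun m hm t ht => ?_⟩
  have hm0 : 0 < m := hδ.trans_le hm
  rw [le_div_iff₀ (by positivity)]
  have h1 := rpow_mul_exp_neg_le hp hc (by positivity : 0 ≤ m ^ r * t)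
  rw [Real.mul_rpow (by positivity) ht.le, ← Real.rpow_mul hm0.le] at h1
  calc m ^ q * Real.exp (-(c * (m ^ r * t))) * t ^ p
      ≤ δ ^ (q - r * p) * m ^ (r * p) * Real.exp (-(c * (m ^ r * t))) * t ^ p := by
        gcongr
        exact rpow_le_mul_rpow hδ hm hqp
    _ = δ ^ (q - r * p) * (m ^ (r * p) * t ^ p * Real.exp (-(c * (m ^ r * t)))) := by ring
    _ ≤ δ ^ (q - r * p) * ((p / c) ^ p + 1) := by gcongr; linarith

/-- For an arbitrary initial state the force is bounded uniformly over the modes, with a bound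
that depends on `t`. -/
lemma exists_rpow_mul_steering_le {δ ρ α r C γ t : ℝ} (hδ : 0 < δ) (hρ : 0 < ρ) (hα : 0 ≤ α)
    (hr0 : 0 < r) (hr : r ≤ α) (hr' : r ≤ 1 - α) (hC : 0 < C) (ht : 0 < t) :
    ∃ K : ℝ, 0 < K ∧ ∀ m, δ ≤ m → ∀ χ χ₁ χ₂, IsCutoff C t χ χ₁ χ₂ →
      ∀ s ∈ Icc 0 t, ∀ z : Pair ℝ,
        m ^ γ * |steering (m ^ (1 / 2 : ℝ)) (ρ * m ^ (α - 1 / 2)) (χ₁ s) (χ₂ s)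
          (flow (m ^ (1 / 2 : ℝ)) (ρ * m ^ α) s z)| ≤ K * ‖z‖ := by
  obtain ⟨k, hk, hdecay⟩ := exists_le_decayRate hδ hρ hr hr'
  obtain ⟨W, hW, hweight⟩ := exists_weight_le (ρ := ρ) hδ hr hr'
  obtain ⟨L, hL, hexp⟩ := exists_rpow_mul_exp_le (q := γ + (α - r)) hδ hr0
    (by positivity : 0 < k / 4)
  set a₀ := ρ * δ ^ α
  have ha₀ : 0 < a₀ := by positivity
  refine ⟨C / t * (4 + 2 / (a₀ * t)) * W * (L / t ^ max ((γ + (α - r)) / r) 0), by positivity,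
    fun m hm χ χ₁ χ₂ hχ s hs z => ?_⟩
  have hm0 : 0 < m := hδ.trans_le hm
  rcases lt_or_ge s (t / 2) with hst | hst
  · obtain ⟨e1, e2⟩ := hχ.first_half s hst
    rw [e1, e2]
    simp only [steering, mul_zero, zero_mul, zero_div, add_zero, abs_zero]
    positivity
  set ω := m ^ (1 / 2 : ℝ)
  set d := ρ * m ^ (α - 1 / 2)
  set a := ρ * m ^ α
  have hω : 0 < ω := by positivity
  have hd0 : 0 < d := by positivity
  have ha : 0 < a := by positivity
  have hd : d * ω = a := by
    simp only [d, ω, a]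
    rw [mul_assoc, ← Real.rpow_add hm0]; congr 2; ring
  set ε := Real.exp (-(k / 4 * (m ^ r * t)))
  have hε : 0 < ε := Real.exp_pos _
  set w := 3 + 2 * d ^ 2
  have hw : 1 ≤ w := by simp only [w]; nlinarith [sq_nonneg d]
  have hw0 : 0 < w := by linarith
  have hE : energy d (flow ω a s z) ≤ (w * ‖z‖ * ε) ^ 2 := by
    have h := energy_flow_le_sq (κ := k * m ^ r) (b := w * ‖z‖) hd ha.le (by positivity)
      (hdecay m hm) hs.1 hst (z := z) (by
        refine (energy_le d z).trans ?_
        have hww : w ≤ w ^ 2 := by nlinarith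
        rw [mul_pow w]
        exact mul_le_mul_of_nonneg_right hww (sq_nonneg _))
    rwa [show k * m ^ r / 4 * t = k / 4 * (m ^ r * t) by ring] at h
  obtain ⟨h1, h2⟩ := abs_steering_le hω hd0.le ht (hχ.bound s hs) (hχ.bound' s hs)
    (by positivity) hE
  set p := flow ω a s z
  have haa : a₀ ≤ a := by
    simp only [a₀, a]
    gcongr
  have h3 : |p.fst| / (ω * t) ≤ 2 * (w * ‖z‖ * ε) / (a₀ * t) := by
    calc |p.fst| / (ω * t) = d * |p.fst| / (a * t) := by rw [← hd]; field_simp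
      _ ≤ 2 * (w * ‖z‖ * ε) / (a₀ * t) := by gcongr
  calc _ ≤ m ^ γ * (C / t * (4 * (w * ‖z‖ * ε) + 2 * (w * ‖z‖ * ε) / (a₀ * t))) := by
        gcongr; exact h1.trans (by gcongr)
    _ = C / t * (4 + 2 / (a₀ * t)) * (m ^ γ * w * ε) * ‖z‖ := by ring
    _ ≤ C / t * (4 + 2 / (a₀ * t)) * (m ^ γ * (W * m ^ (α - r)) * ε) * ‖z‖ := by
        gcongr; exact hweight m hm
    _ = C / t * (4 + 2 / (a₀ * t)) * (W * (m ^ (γ + (α - r)) * ε)) * ‖z‖ := by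
        rw [Real.rpow_add hm0]; ring
    _ ≤ C / t * (4 + 2 / (a₀ * t)) * (W * (L / t ^ max ((γ + (α - r)) / r) 0)) * ‖z‖ := by
        gcongr; exact hexp m hm t ht
    _ = _ := by ring

end Bounds

/-! ### The semigroup generated by a block-diagonal operator -/

section Semigroup

variable {H E : Type*} [NormedAddCommGroup H] [InnerProductSpace ℝ H]
  [NormedAddCommGroup E] [InnerProductSpace ℝ E] [CompleteSpace E]
  {Φ : H ≃ₗᵢ[ℝ] SeqL2 E} {M : ℕ → E →L[ℝ] E} {A : H →ₗ.[ℝ] H}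

lemma tendsto_slope_expFlow (M : E →L[ℝ] E) (z : E) :
    Tendsto (fun t : ℝ => t⁻¹ • (expFlow M t z - z)) (𝓝[>] 0) (𝓝 (M z)) := by
  have h := (hasDerivAt_expFlow_apply M 0 z).hasDerivWithinAt (s := Ioi 0)
  rw [hasDerivWithinAt_iff_tendsto_slope' (by simp)] at h
  rw [expFlow_zero] at h
  refine h.congr fun t => ?_
  simp [slope_def_module, expFlow_zero]

lemma norm_expFlow_sub_le {M : E →L[ℝ] E} (hM : ∀ t, 0 ≤ t → ∀ z, ‖expFlow M t z‖ ≤ ‖z‖)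
    {t : ℝ} (ht : 0 ≤ t) (z : E) : ‖expFlow M t z - z‖ ≤ ‖M z‖ * t := by
  have hd : ∀ s, HasDerivAt (fun s => expFlow M s z) (expFlow M s (M z)) s := fun s => by
    simpa using (hasDerivAt_expFlow M s).clm_apply (hasDerivAt_const s z)
  have h := norm_image_sub_le_of_norm_deriv_le_segment' (f := fun s => expFlow M s z)
    (fun x _ => (hd x).hasDerivWithinAt) (fun x hx => hM x hx.1 (M z)) t (right_mem_Icc.2 ht)
  simpa [expFlow_zero] using h

/-- A block-diagonal operator with dissipative blocks generates a semigroup. -/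
lemma exists_isSemigroupOf
    (hA : ∀ x y : H, (x, y) ∈ A.graph ↔ ∀ n, Φ y n = M n (Φ x n))
    (hM : ∀ n t, 0 ≤ t → ∀ z, ‖expFlow (M n) t z‖ ≤ ‖z‖) :
    ∃ S : ℝ → H →L[ℝ] H, IsSemigroupOf A S ∧
      ∀ t, 0 ≤ t → IsBlockDiag Φ Φ (S t) (fun n => expFlow (M n) t) := by
  have hex : ∀ t : ℝ, ∃ D : H →L[ℝ] H,
      IsBlockDiag Φ Φ D (fun n => expFlow (M n) (max t 0)) := fun t =>
    exists_isBlockDiag Φ Φ (C := 1) _ fun n z => by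
      simpa using hM n _ (le_max_right t 0) z
  choose S hS' using hex
  have hS : ∀ t, 0 ≤ t → IsBlockDiag Φ Φ (S t) (fun n => expFlow (M n) t) := fun t ht => by
    simpa [max_eq_left ht] using hS' t
  refine ⟨S, ⟨?_, fun s t hs ht => ?_, fun x => ?_, fun x y => ?_⟩, hS⟩
  · ext x
    refine ext_coords Φ fun n => ?_
    refine (hS 0 le_rfl x n).trans ?_
    change expFlow (M n) 0 (Φ x n) = Φ x n
    rw [expFlow_zero]
    rfl
  · ext x
    refine ext_coords Φ fun n => ?_
    rw [ContinuousLinearMap.comp_apply, hS s hs, hS t ht]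
    refine (hS _ (add_nonneg hs ht) x n).trans ?_
    change expFlow (M n) (s + t) (Φ x n) = _
    rw [expFlow_add]
    rfl
  · refine continuousOn_of_coords Φ (summable_norm_sq_coords Φ x) (fun n => ?_) fun t ht n => ?_
    · refine ContinuousOn.congr (f := fun t => expFlow (M n) t (Φ x n)) ?_ fun t ht => hS t ht x n
      exact ((continuous_expFlow (M n)).clm_apply continuous_const).continuousOn
    · rw [hS t ht]
      exact hM n t ht _
  · have hcoord : ∀ n, ∀ᶠ t in 𝓝[>] (0 : ℝ),
        t⁻¹ • (expFlow (M n) t (Φ x n) - Φ x n) = Φ (t⁻¹ • (S t x - x)) n := fun n => by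
      filter_upwards [self_mem_nhdsWithin] with t ht
      rw [coords_smul, coords_sub, hS t (le_of_lt ht) x n]
    rw [hA]
    constructor
    · intro hxy
      refine tendsto_of_coords Φ (g := fun n => 2 * ‖Φ y n‖) ?_ (fun n => ?_) ?_
      · simpa [mul_pow] using (summable_norm_sq_coords Φ y).mul_left (2 ^ 2)
      · rw [hxy n]
        exact (tendsto_slope_expFlow (M n) (Φ x n)).congr' (hcoord n)
      · filter_upwards [self_mem_nhdsWithin] with t (ht : 0 < t) n
        have h1 : ‖t⁻¹ • (expFlow (M n) t (Φ x n) - Φ x n)‖ ≤ ‖Φ y n‖ := by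
          rw [norm_smul, hxy n, norm_inv, Real.norm_of_nonneg ht.le, inv_mul_le_iff₀ ht, mul_comm]
          exact norm_expFlow_sub_le (hM n) ht.le _
        have h2 : Φ (t⁻¹ • (S t x - x)) n = t⁻¹ • (expFlow (M n) t (Φ x n) - Φ x n) := by
          rw [coords_smul, coords_sub, hS t ht.le x n]
        rw [h2]
        calc _ ≤ _ := norm_sub_le _ _
          _ ≤ 2 * ‖Φ y n‖ := by linarith
    · intro hlim n
      have h1 := ((coordCLM Φ n).continuous.tendsto y).comp hlim
      exact tendsto_nhds_unique h1 ((tendsto_slope_expFlow (M n) (Φ x n)).congr' (hcoord n))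

lemma IsSemigroupOf.hasDerivWithinAt {S : ℝ → H →L[ℝ] H} (hS : IsSemigroupOf A S) {x y : H}
    (hxy : (x, y) ∈ A.graph) {s : ℝ} (hs : 0 ≤ s) :
    HasDerivWithinAt (fun t => S t x) (S s y) (Ici s) s := by
  rw [← hasDerivWithinAt_Ioi_iff_Ici, hasDerivWithinAt_iff_tendsto_slope' (by simp)]
  have h1 : Tendsto (fun t : ℝ => t - s) (𝓝[>] s) (𝓝[>] 0) := by
    refine tendsto_nhdsWithin_iff.2 ⟨?_, ?_⟩
    · have : Tendsto (fun t : ℝ => t - s) (𝓝 s) (𝓝 (s - s)) := tendsto_id.sub_const s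
      rw [sub_self] at this
      exact this.mono_left nhdsWithin_le_nhds
    · filter_upwards [self_mem_nhdsWithin] with t (ht : s < t)
      exact sub_pos.2 ht
  have h2 := ((S s).continuous.tendsto y).comp (((hS.generator x y).1 hxy).comp h1)
  refine h2.congr' ?_
  filter_upwards [self_mem_nhdsWithin] with t (ht : s < t)
  have e : S t x = S s (S (t - s) x) := by
    have := hS.add s (t - s) hs (sub_nonneg.2 ht.le)
    rw [add_sub_cancel] at this
    rw [this]; rfl
  simp [slope_def_module, e]

lemma IsSemigroupOf.graph_invariant {S : ℝ → H →L[ℝ] H} (hS : IsSemigroupOf A S) {x y : H}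
    (hxy : (x, y) ∈ A.graph) {s : ℝ} (hs : 0 ≤ s) : (S s x, S s y) ∈ A.graph := by
  rw [hS.generator]
  refine (((S s).continuous.tendsto y).comp ((hS.generator x y).1 hxy)).congr' ?_
  filter_upwards [self_mem_nhdsWithin] with t (ht : 0 < t)
  have e : S t (S s x) = S s (S t x) := by
    have h1 := hS.add t s ht.le hs
    have h2 := hS.add s t hs ht.le
    rw [add_comm, h2] at h1
    exact (DFunLike.congr_fun h1 x).symm
  simp [e]

/-- A semigroup generated by a block-diagonal operator is block-diagonal: the components of an
orbit in the domain solve `z' = M n z`. -/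
lemma IsSemigroupOf.isBlockDiag {S : ℝ → H →L[ℝ] H} (hS : IsSemigroupOf A S)
    (hA : ∀ x y : H, (x, y) ∈ A.graph ↔ ∀ n, Φ y n = M n (Φ x n))
    (hM : ∀ n t, 0 ≤ t → ∀ z, ‖expFlow (M n) t z‖ ≤ ‖z‖) {t : ℝ} (ht : 0 ≤ t) :
    IsBlockDiag Φ Φ (S t) (fun n => expFlow (M n) t) := by
  have hdom : ∀ x y : H, (x, y) ∈ A.graph → ∀ n, Φ (S t x) n = expFlow (M n) t (Φ x n) := by
    intro x y hxy n
    refine ODE_solution_unique (v := fun _ => M n) (K := ‖M n‖₊) (a := 0) (b := t)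
      (f := fun s => Φ (S s x) n) (g := fun s => expFlow (M n) s (Φ x n))
      (fun _ => (M n).lipschitz) ?_ (fun s hs => ?_) ?_ (fun s _ => ?_) ?_ (right_mem_Icc.2 ht)
    · exact (coordCLM Φ n).continuous.comp_continuousOn
        ((hS.continuous x).mono Icc_subset_Ici_self)
    · have h1 := (coordCLM Φ n).hasFDerivAt.comp_hasDerivWithinAt s
        (hS.hasDerivWithinAt hxy hs.1)
      exact h1.congr_deriv ((hA _ _).1 (hS.graph_invariant hxy hs.1) n)
    · exact ((continuous_expFlow (M n)).clm_apply continuous_const).continuousOn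
    · exact (hasDerivAt_expFlow_apply (M n) s (Φ x n)).hasDerivWithinAt
    · simp [hS.zero, expFlow_zero]
  obtain ⟨D, hD⟩ := exists_isBlockDiag Φ Φ (C := 1) (fun n => expFlow (M n) t) fun n z => by
    simpa using hM n t ht z
  have : S t = D := by
    refine ext_blockVec Φ fun n z => ext_coords Φ fun m => ?_
    rw [hD]
    refine hdom _ (blockVec Φ n (M n z)) ((hA _ _).2 fun k => ?_) m
    by_cases hk : k = n
    · subst hk; rw [blockVec_coord_self, blockVec_coord_self]
    · rw [blockVec_coord_ne Φ hk, blockVec_coord_ne Φ hk, map_zero]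
  rwa [this]

end Semigroup

/-! ### Assembling null controls from the modes -/

section NullControl

variable {U H E : Type*} [NormedAddCommGroup U] [InnerProductSpace ℝ U]
  [NormedAddCommGroup H] [InnerProductSpace ℝ H] [CompleteSpace H]
  [NormedAddCommGroup E] [InnerProductSpace ℝ E] [CompleteSpace E]
  {Φ : U ≃ₗᵢ[ℝ] SeqL2 ℝ} {Ψ : H ≃ₗᵢ[ℝ] SeqL2 E}
  {S : ℝ → H →L[ℝ] H} {T : ℕ → ℝ → E →L[ℝ] E} {G : U →L[ℝ] H} {g : ℕ → ℝ →L[ℝ] E}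

/-- `u` steers `z` to rest in time `t`, for the evolution `T` and the input operator `g`. -/
def Steers (T : ℝ → E →L[ℝ] E) (g : ℝ →L[ℝ] E) (t : ℝ) (z : E) (u : ℝ → ℝ) : Prop :=
  Continuous u ∧ T t z + ∫ s in (0 : ℝ)..t, T (t - s) (g (u s)) = 0

lemma coords_intervalIntegral {f : ℝ → H} {t : ℝ} (ht : 0 ≤ t) (hf : ContinuousOn f (Icc 0 t))
    (n : ℕ) : Ψ (∫ s in (0 : ℝ)..t, f s) n = ∫ s in (0 : ℝ)..t, Ψ (f s) n := by
  have h := (coordCLM Ψ n).intervalIntegral_comp_comm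
    (ContinuousOn.intervalIntegrable (μ := volume) (u := f) (by rwa [uIcc_of_le ht]))
  exact h.symm

lemma exists_mem_nullControls (hT : ∀ n, Continuous (T n))
    (hT1 : ∀ n s, 0 ≤ s → ∀ z, ‖T n s z‖ ≤ ‖z‖)
    (hS : ∀ s, 0 ≤ s → IsBlockDiag Ψ Ψ (S s) (fun n => T n s))
    (hG : IsBlockDiag Φ Ψ G g) {C : ℝ} (hg : ∀ n c, ‖g n c‖ ≤ C * ‖c‖)
    {t : ℝ} (ht : 0 ≤ t) {h : H} {u : ℕ → ℝ → ℝ} (hu : ∀ n, Steers (T n) (g n) t (Ψ h n) (u n))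
    {b : ℕ → ℝ} (hb : Summable fun n => b n ^ 2) (hub : ∀ n, ∀ s ∈ Icc 0 t, ‖u n s‖ ≤ b n) :
    ∃ w ∈ nullControls S G t h, ∀ s ∈ Icc 0 t, ∀ n, Φ (w s) n = u n s := by
  have hex : ∀ s : ℝ, ∃ x : U, s ∈ Icc 0 t → ∀ n, Φ x n = u n s := fun s => by
    by_cases hs : s ∈ Icc 0 t
    · obtain ⟨x, hx⟩ := exists_coords_eq Φ (z := fun n => u n s)
        (Summable.of_nonneg_of_le (fun n => by positivity)
          (fun n => pow_le_pow_left₀ (norm_nonneg _) (hub n s hs) 2) hb)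
      exact ⟨x, fun _ => hx⟩
    · exact ⟨0, fun h => absurd h hs⟩
  choose w hw using hex
  have hwc : ContinuousOn w (Icc 0 t) := by
    refine continuousOn_of_coords Φ hb (fun n => ?_) fun s hs n => ?_
    · exact (hu n).1.continuousOn.congr fun s hs => hw s hs n
    · rw [hw s hs]; exact hub n s hs
  have hcoord : ∀ s ∈ Icc 0 t, ∀ n, Ψ (S (t - s) (G (w s))) n = T n (t - s) (g n (u n s)) :=
    fun s hs n => by rw [hS _ (sub_nonneg.2 hs.2), hG, hw s hs]
  have hic : ContinuousOn (fun s => S (t - s) (G (w s))) (Icc 0 t) := by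
    refine continuousOn_of_coords Ψ (g := fun n => C * b n) ?_ (fun n => ?_) fun s hs n => ?_
    · simpa [mul_pow] using hb.mul_left (C ^ 2)
    · refine ContinuousOn.congr (f := fun s => T n (t - s) (g n (u n s))) ?_
        fun s hs => hcoord s hs n
      exact (((hT n).comp (continuous_const.sub continuous_id)).clm_apply
        ((g n).continuous.comp (hu n).1)).continuousOn
    · have hC : 0 ≤ C := by simpa using (norm_nonneg _).trans (hg n 1)
      rw [hcoord s hs]
      calc _ ≤ ‖g n (u n s)‖ := hT1 n _ (sub_nonneg.2 hs.2) _
        _ ≤ C * ‖u n s‖ := hg n _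
        _ ≤ C * b n := by gcongr; exact hub n s hs
  refine ⟨w, ⟨?_, ?_⟩, hw⟩
  · obtain ⟨B, hB⟩ := isCompact_Icc.exists_bound_of_continuousOn hwc
    exact MemLp.of_bound (hwc.aestronglyMeasurable measurableSet_Icc) B
      ((ae_restrict_iff' measurableSet_Icc).2 (Eventually.of_forall hB))
  · refine ext_coords Ψ fun n => ?_
    have h1 : Ψ (mildSolution S G h w t) n =
        Ψ (S t h) n + Ψ (∫ s in (0 : ℝ)..t, S (t - s) (G (w s))) n := by
      rw [mildSolution, map_add]; rfl
    rw [h1, coords_intervalIntegral ht hic, hS t ht, map_zero]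
    refine Eq.trans ?_ (hu n).2
    congr 1
    refine intervalIntegral.integral_congr fun s hs => ?_
    rw [uIcc_of_le ht] at hs
    exact hcoord s hs n

/-- A bound, uniform over the modes, for scalar controls that steer the modes of `V v` to rest
bounds the minimal energy. -/
lemma minEnergy_le (hT : ∀ n, Continuous (T n))
    (hT1 : ∀ n s, 0 ≤ s → ∀ z, ‖T n s z‖ ≤ ‖z‖)
    (hS : ∀ s, 0 ≤ s → IsBlockDiag Ψ Ψ (S s) (fun n => T n s))
    (hG : IsBlockDiag Φ Ψ G g) {C : ℝ} (hg : ∀ n c, ‖g n c‖ ≤ C * ‖c‖)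
    {V : U →L[ℝ] H} {f : ℕ → ℝ →L[ℝ] E} (hV : IsBlockDiag Φ Ψ V f) {t B : ℝ} (ht : 0 ≤ t)
    (hB : 0 ≤ B)
    (hctrl : ∀ n c, ∃ u, Steers (T n) (g n) t (f n c) u ∧ ∀ s ∈ Icc 0 t, |u s| ≤ B * |c|)
    (v : U) : minEnergy S G t (V v) ≤ ENNReal.ofReal (B * √t * ‖v‖) := by
  choose u hu hub using fun n => hctrl n (Φ v n)
  obtain ⟨w, hw, hwu⟩ := exists_mem_nullControls (h := V v) (b := fun n => B * |Φ v n|)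
    hT hT1 hS hG hg ht
    (fun n => by rw [hV]; exact hu n)
    (by simpa [mul_pow] using (summable_norm_sq_coords Φ v).mul_left (B ^ 2)) hub
  have hbound : ∀ s ∈ Icc 0 t, ‖w s‖ ≤ B * ‖v‖ := fun s hs =>
    norm_le_of_coords Φ Φ hB fun n => by rw [hwu s hs]; exact hub n s hs
  refine (iInf₂_le w hw).trans ?_
  refine (eLpNorm_le_of_ae_bound
    ((ae_restrict_iff' measurableSet_Icc).2 (Eventually.of_forall hbound))).trans ?_
  rw [Measure.restrict_apply_univ, Real.volume_Icc, sub_zero,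
    ENNReal.ofReal_rpow_of_nonneg ht (by norm_num), ← ENNReal.ofReal_mul (by positivity)]
  refine ENNReal.ofReal_le_ofReal (le_of_eq ?_)
  rw [Real.sqrt_eq_rpow]
  norm_num
  ring

end NullControl

/-! ### The Gramian, its square root and the operator `Γ` -/

section Gramian

lemma norm_adjoint_apply_le {F K : Type*} [NormedAddCommGroup F] [InnerProductSpace ℝ F]
    [CompleteSpace F] [NormedAddCommGroup K] [InnerProductSpace ℝ K] [CompleteSpace K]
    {A : F →L[ℝ] K} {C : ℝ} (hC : 0 ≤ C) (hA : ∀ x, ‖A x‖ ≤ C * ‖x‖) (y : K) :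
    ‖A.adjoint y‖ ≤ C * ‖y‖ := by
  refine A.adjoint.le_of_opNorm_le ?_ y
  rw [LinearIsometryEquiv.norm_map]
  exact A.opNorm_le_bound hC hA

variable {E : Type*} [NormedAddCommGroup E] [InnerProductSpace ℝ E]

lemma exists_sqrt [FiniteDimensional ℝ E] {Q : E →L[ℝ] E}
    (hQ : ∀ x y, ⟪Q x, y⟫_ℝ = ⟪x, Q y⟫_ℝ) (hQ0 : ∀ x, 0 ≤ ⟪Q x, x⟫_ℝ) :
    ∃ R : E →L[ℝ] E, (∀ x y, ⟪R x, y⟫_ℝ = ⟪x, R y⟫_ℝ) ∧ (∀ x, 0 ≤ ⟪R x, x⟫_ℝ) ∧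
      ∀ x, R (R x) = Q x := by
  have hs : (Q : E →ₗ[ℝ] E).IsSymmetric := hQ
  set b := hs.eigenvectorBasis rfl
  set l := hs.eigenvalues rfl
  have hl : ∀ i, Q (b i) = l i • b i := fun i => hs.apply_eigenvectorBasis rfl i
  have hl0 : ∀ i, 0 ≤ l i := fun i => by
    have h := hQ0 (b i)
    rw [hl, real_inner_smul_left, real_inner_self_eq_norm_sq, b.norm_eq_one] at h
    simpa using h
  set R : E →L[ℝ] E := ∑ i, √(l i) • (innerSL ℝ (b i)).smulRight (b i)
  have hR : ∀ x, R x = ∑ i, √(l i) • ⟪b i, x⟫_ℝ • b i := fun x => by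
    simp [R]
  have hRb : ∀ i, R (b i) = √(l i) • b i := fun i => by
    rw [hR, Finset.sum_eq_single i]
    · simp
    · intro j _ hj
      simp [b.orthonormal.2 hj]
    · simp
  refine ⟨R, fun x y => ?_, fun x => ?_, fun x => ?_⟩
  · simp only [hR, sum_inner, inner_sum, real_inner_smul_left, real_inner_smul_right]
    refine Finset.sum_congr rfl fun i _ => ?_
    rw [real_inner_comm x (b i)]
    ring
  · simp only [hR, sum_inner, real_inner_smul_left]
    exact Finset.sum_nonneg fun i _ => mul_nonneg (Real.sqrt_nonneg _) (mul_self_nonneg _)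
  · have : (R ∘L R : E →L[ℝ] E).toLinearMap = Q.toLinearMap := by
      refine b.toBasis.ext fun i => ?_
      simp only [OrthonormalBasis.coe_toBasis]
      change R (R (b i)) = Q (b i)
      rw [hRb, map_smul, hRb, smul_smul, Real.mul_self_sqrt (hl0 i), hl]
    exact LinearMap.congr_fun this x

lemma sq_integral_abs_le {f : ℝ → ℝ} (hf : Continuous f) {t : ℝ} (ht : 0 < t) :
    (∫ s in (0 : ℝ)..t, |f s|) ^ 2 ≤ t * ∫ s in (0 : ℝ)..t, f s ^ 2 := by
  set I := ∫ s in (0 : ℝ)..t, |f s|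
  have h0 : 0 ≤ ∫ s in (0 : ℝ)..t, (|f s| - I / t) ^ 2 :=
    intervalIntegral.integral_nonneg ht.le fun s _ => sq_nonneg _
  have h1 : ∫ s in (0 : ℝ)..t, (|f s| - I / t) ^ 2 =
      (∫ s in (0 : ℝ)..t, f s ^ 2) - 2 * (I / t) * I + (I / t) ^ 2 * t := by
    have e : ∀ s, (|f s| - I / t) ^ 2 = f s ^ 2 - 2 * (I / t) * |f s| + (I / t) ^ 2 := fun s => by
      rw [sub_sq, sq_abs]; ring
    simp only [e]
    rw [intervalIntegral.integral_add (Continuous.intervalIntegrable (by fun_prop) _ _)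
        (Continuous.intervalIntegrable (by fun_prop) _ _),
      intervalIntegral.integral_sub (Continuous.intervalIntegrable (by fun_prop) _ _)
        (Continuous.intervalIntegrable (by fun_prop) _ _),
      intervalIntegral.integral_const_mul, intervalIntegral.integral_const]
    simp only [sub_zero, smul_eq_mul]
    ring
  rw [h1] at h0
  have h2 : (I / t) * t = I := div_mul_cancel₀ _ ht.ne'
  have h3 : 0 ≤ t * ((∫ s in (0 : ℝ)..t, f s ^ 2) - 2 * (I / t) * I + (I / t) ^ 2 * t) :=
    mul_nonneg ht.le h0
  have h4 : t * ((∫ s in (0 : ℝ)..t, f s ^ 2) - 2 * (I / t) * I + (I / t) ^ 2 * t) =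
      t * (∫ s in (0 : ℝ)..t, f s ^ 2) - I ^ 2 := by
    field_simp
    ring
  linarith

variable [CompleteSpace E]

lemma continuous_adjoint_comp {T : ℝ → E →L[ℝ] E} (hT : Continuous T) (g : ℝ →L[ℝ] E) (z : E) :
    Continuous fun s => g.adjoint ((T s).adjoint z) :=
  g.adjoint.continuous.comp
    ((ContinuousLinearMap.adjoint.continuous.comp hT).clm_apply continuous_const)

variable {U H : Type*} [NormedAddCommGroup U] [InnerProductSpace ℝ U] [CompleteSpace U]
  [NormedAddCommGroup H] [InnerProductSpace ℝ H] [CompleteSpace H]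
  {Φ : U ≃ₗᵢ[ℝ] SeqL2 ℝ} {Ψ : H ≃ₗᵢ[ℝ] SeqL2 E}
  {S : ℝ → H →L[ℝ] H} {T : ℕ → ℝ → E →L[ℝ] E} {G : U →L[ℝ] H} {g : ℕ → ℝ →L[ℝ] E}

lemma coords_gramian (hT : ∀ n, Continuous (T n))
    (hT1 : ∀ n s, 0 ≤ s → ∀ z, ‖T n s z‖ ≤ ‖z‖)
    (hS : ∀ s, 0 ≤ s → IsBlockDiag Ψ Ψ (S s) (fun n => T n s))
    (hG : IsBlockDiag Φ Ψ G g) {C : ℝ} (hC : 0 ≤ C) (hg : ∀ n c, ‖g n c‖ ≤ C * ‖c‖)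
    {t : ℝ} (ht : 0 ≤ t) (h : H) (n : ℕ) :
    Ψ (gramian S G t h) n =
      ∫ s in (0 : ℝ)..t, T n s (g n ((g n).adjoint ((T n s).adjoint (Ψ h n)))) := by
  have hcoord : ∀ s ∈ Icc 0 t, ∀ n, Ψ (S s (G (G.adjoint ((S s).adjoint h)))) n =
      T n s (g n ((g n).adjoint ((T n s).adjoint (Ψ h n)))) := fun s hs n => by
    rw [hS s hs.1, hG, hG.adjoint, (hS s hs.1).adjoint]
  have hc : ContinuousOn (fun s => S s (G (G.adjoint ((S s).adjoint h)))) (Icc 0 t) := by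
    refine continuousOn_of_coords Ψ (g := fun n => C * (C * ‖Ψ h n‖)) ?_ (fun n => ?_)
      fun s hs n => ?_
    · exact ((summable_norm_sq_coords Ψ h).mul_left ((C * C) ^ 2)).congr fun n => by ring
    · refine ContinuousOn.congr
        (f := fun s => T n s (g n ((g n).adjoint ((T n s).adjoint (Ψ h n))))) ?_
        fun s hs => hcoord s hs n
      have h1 := continuous_adjoint_comp (hT n) (g n) (Ψ h n)
      have h2 : Continuous fun s => g n ((g n).adjoint ((T n s).adjoint (Ψ h n))) :=
        (g n).continuous.comp h1
      exact ((hT n).clm_apply h2).continuousOn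
    · rw [hcoord s hs]
      calc _ ≤ _ := hT1 n s hs.1 _
        _ ≤ C * ‖(g n).adjoint ((T n s).adjoint (Ψ h n))‖ := hg n _
        _ ≤ C * (C * ‖(T n s).adjoint (Ψ h n)‖) := by
          gcongr
          exact norm_adjoint_apply_le hC (hg n) _
        _ ≤ C * (C * ‖Ψ h n‖) := by
          gcongr
          simpa using norm_adjoint_apply_le zero_le_one (by simpa using hT1 n s hs.1) (Ψ h n)
  rw [gramian, coords_intervalIntegral ht hc]
  refine intervalIntegral.integral_congr fun s hs => ?_
  rw [uIcc_of_le ht] at hs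
  exact hcoord s hs n

variable [FiniteDimensional ℝ E]

/-- For one mode: a controllable system has an invertible Gramian `R²`, and the norm of
`Γ z = R⁻¹ T t z` is at most the energy of any control that steers `z` to rest. -/
lemma exists_gamma_of_steers {T : ℝ → E →L[ℝ] E} (hT : Continuous T) {g : ℝ →L[ℝ] E} {t : ℝ}
    (ht : 0 < t) (hsurj : Function.Surjective (T t)) (hctrl : ∀ z, ∃ u, Steers T g t z u) :
    ∃ R Γ : E →L[ℝ] E, (∀ x y, ⟪R x, y⟫_ℝ = ⟪x, R y⟫_ℝ) ∧ (∀ x, 0 ≤ ⟪R x, x⟫_ℝ) ∧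
      (∀ z, R (R z) = ∫ s in (0 : ℝ)..t, T s (g (g.adjoint ((T s).adjoint z)))) ∧
      (∀ z, ‖R z‖ ^ 2 = ∫ s in (0 : ℝ)..t, g.adjoint ((T s).adjoint z) ^ 2) ∧
      Function.Injective R ∧ (∀ z, R (Γ z) = T t z) ∧
      ∀ z u B, Steers T g t z u → (∀ s ∈ Icc 0 t, |u s| ≤ B) → ‖Γ z‖ ≤ B * √t := by
  have hTadj : Continuous fun s => (T s).adjoint :=
    ContinuousLinearMap.adjoint.continuous.comp hT
  set P : ℝ → E →L[ℝ] E := fun s => T s ∘L g ∘L g.adjoint ∘L (T s).adjoint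
  have hP : Continuous P :=
    hT.clm_comp (continuous_const.clm_comp (continuous_const.clm_comp hTadj))
  set Q : E →L[ℝ] E := ∫ s in (0 : ℝ)..t, P s
  have hQ : ∀ z, Q z = ∫ s in (0 : ℝ)..t, T s (g (g.adjoint ((T s).adjoint z))) := fun z =>
    ContinuousLinearMap.intervalIntegral_apply (hP.intervalIntegrable _ _) z
  have hf := continuous_adjoint_comp hT g
  have hQi : ∀ z w, ⟪Q z, w⟫_ℝ =
      ∫ s in (0 : ℝ)..t, g.adjoint ((T s).adjoint z) * g.adjoint ((T s).adjoint w) := by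
    intro z w
    rw [hQ, real_inner_comm, ← innerSL_apply_apply ℝ, ← ContinuousLinearMap.intervalIntegral_comp_comm]
    · refine intervalIntegral.integral_congr fun s _ => ?_
      rw [innerSL_apply_apply, ← ContinuousLinearMap.adjoint_inner_left,
        ← ContinuousLinearMap.adjoint_inner_left]
      rfl
    · exact (hT.clm_apply (g.continuous.comp (hf z))).intervalIntegrable _ _
  obtain ⟨R, hRs, hR0, hRR⟩ := exists_sqrt (Q := Q)
    (fun x y => by
      rw [hQi, real_inner_comm, hQi]
      simp only [mul_comm])
    (fun x => by
      rw [hQi]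
      exact intervalIntegral.integral_nonneg ht.le fun s _ => mul_self_nonneg _)
  have hRn : ∀ z, ‖R z‖ ^ 2 = ∫ s in (0 : ℝ)..t, g.adjoint ((T s).adjoint z) ^ 2 := fun z => by
    rw [← real_inner_self_eq_norm_sq, ← hRs, hRR, hQi]
    simp only [sq]
  -- duality between steering and observation
  have key : ∀ z u B, Steers T g t z u → (∀ s ∈ Icc 0 t, |u s| ≤ B) →
      ∀ w, |⟪T t z, w⟫_ℝ| ≤ B * √t * ‖R w‖ := by
    rintro z u B ⟨hu, hsteer⟩ hB w
    have hB0 : 0 ≤ B := (abs_nonneg _).trans (hB 0 ⟨le_rfl, ht.le⟩)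
    set f : ℝ → ℝ := fun s => g.adjoint ((T s).adjoint w)
    have hfc : Continuous f := hf w
    have h1 : ⟪T t z, w⟫_ℝ = -∫ s in (0 : ℝ)..t, u s * f (t - s) := by
      rw [eq_neg_of_add_eq_zero_left hsteer, inner_neg_left, real_inner_comm,
        ← innerSL_apply_apply ℝ, ← ContinuousLinearMap.intervalIntegral_comp_comm]
      · congr 1
        refine intervalIntegral.integral_congr fun s _ => ?_
        rw [innerSL_apply_apply, ← ContinuousLinearMap.adjoint_inner_left,
          ← ContinuousLinearMap.adjoint_inner_left]
        rfl
      · exact ((hT.comp (continuous_const.sub continuous_id)).clm_apply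
          (g.continuous.comp hu)).intervalIntegrable _ _
    have h2 : |∫ s in (0 : ℝ)..t, u s * f (t - s)| ≤ ∫ s in (0 : ℝ)..t, B * |f (t - s)| := by
      refine (intervalIntegral.abs_integral_le_integral_abs ht.le).trans ?_
      refine intervalIntegral.integral_mono_on ht.le
        (Continuous.intervalIntegrable (by fun_prop) _ _)
        (Continuous.intervalIntegrable (by fun_prop) _ _) fun s hs => ?_
      rw [abs_mul]
      exact mul_le_mul_of_nonneg_right (hB s hs) (abs_nonneg _)
    have h3 : ∫ s in (0 : ℝ)..t, B * |f (t - s)| = B * ∫ s in (0 : ℝ)..t, |f s| := by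
      rw [intervalIntegral.integral_const_mul,
        intervalIntegral.integral_comp_sub_left (fun s => |f s|) t, sub_self, sub_zero]
    have h4 : (∫ s in (0 : ℝ)..t, |f s|) ≤ √t * ‖R w‖ := by
      refine le_of_sq_le_sq ?_ (by positivity)
      rw [mul_pow, Real.sq_sqrt ht.le, hRn]
      exact sq_integral_abs_le hfc ht
    rw [h1, abs_neg]
    calc _ ≤ B * ∫ s in (0 : ℝ)..t, |f s| := h2.trans h3.le
      _ ≤ B * (√t * ‖R w‖) := by gcongr
      _ = _ := by ring
  have hinj : Function.Injective R := by
    rw [injective_iff_map_eq_zero]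
    intro w hw
    obtain ⟨z, hz⟩ := hsurj w
    obtain ⟨u, hu⟩ := hctrl z
    obtain ⟨B, hB⟩ := (isCompact_Icc (a := (0 : ℝ)) (b := t)).exists_bound_of_continuousOn
      hu.1.continuousOn
    have h := key z u B hu hB w
    rw [hw, norm_zero, mul_zero, hz, real_inner_self_eq_norm_sq] at h
    have h2 : ‖w‖ ^ 2 = 0 := abs_eq_zero.1 (le_antisymm h (abs_nonneg _))
    simpa using h2
  have hRsurj : Function.Surjective R :=
    (LinearMap.injective_iff_surjective (f := (R : E →ₗ[ℝ] E))).1 hinj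
  set e : E ≃ₗ[ℝ] E := LinearEquiv.ofBijective (R : E →ₗ[ℝ] E) ⟨hinj, hRsurj⟩
  have he : ∀ z, R (e.symm z) = z := fun z => e.apply_symm_apply z
  refine ⟨R, LinearMap.toContinuousLinearMap (e.symm.toLinearMap ∘ₗ (T t).toLinearMap), hRs, hR0,
    fun z => by rw [hRR, hQ], hRn, hinj, fun z => he _, fun z u B hu hB => ?_⟩
  set y : E := e.symm (T t z)
  change ‖y‖ ≤ B * √t
  have hy : R y = T t z := he _
  obtain ⟨w, hw⟩ := hRsurj y
  have h := key z u B hu hB w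
  rw [← hy, hRs, hw, real_inner_self_eq_norm_sq, abs_of_nonneg (by positivity), sq] at h
  rcases (norm_nonneg y).eq_or_lt with h0 | h0
  · have hB0 : 0 ≤ B := (abs_nonneg _).trans (hB 0 ⟨le_rfl, ht.le⟩)
    rw [← h0]; positivity
  · exact le_of_mul_le_mul_right h h0

/-- The operator `Γ` of a system that is controllable mode by mode, with bounds for the controls
that are uniform over the modes. -/
lemma exists_isGammaOperator (hT : ∀ n, Continuous (T n))
    (hT1 : ∀ n s, 0 ≤ s → ∀ z, ‖T n s z‖ ≤ ‖z‖)
    (hS : ∀ s, 0 ≤ s → IsBlockDiag Ψ Ψ (S s) (fun n => T n s))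
    (hG : IsBlockDiag Φ Ψ G g) {C : ℝ} (hC : 0 ≤ C) (hg : ∀ n c, ‖g n c‖ ≤ C * ‖c‖)
    {V : U →L[ℝ] H} {f : ℕ → ℝ →L[ℝ] E} (hV : IsBlockDiag Φ Ψ V f) {t B D : ℝ} (ht : 0 < t)
    (hB : 0 ≤ B) (hsurj : ∀ n, Function.Surjective (T n t))
    (hctrl : ∀ n c, ∃ u, Steers (T n) (g n) t (f n c) u ∧ ∀ s ∈ Icc 0 t, |u s| ≤ B * |c|)
    (hctrl' : ∀ n z, ∃ u, Steers (T n) (g n) t z u ∧ ∀ s ∈ Icc 0 t, |u s| ≤ D * ‖z‖) :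
    ∃ Γ : H →L[ℝ] H, IsGammaOperator S G t Γ ∧ ‖Γ ∘L V‖ ≤ B * √t := by
  choose R Γ hRs hR0 hRR hRn hRinj hRΓ hΓ using fun n =>
    exists_gamma_of_steers (hT n) (g := g n) ht (hsurj n)
      fun z => (hctrl' n z).imp fun _ hu => hu.1
  have hRb : ∀ n z, ‖R n z‖ ≤ √t * C * ‖z‖ := by
    intro n z
    refine le_of_sq_le_sq ?_ (by positivity)
    rw [hRn]
    have hle : ∫ s in (0 : ℝ)..t, (g n).adjoint ((T n s).adjoint z) ^ 2 ≤
        ∫ _ in (0 : ℝ)..t, (C * ‖z‖) ^ 2 := by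
      refine intervalIntegral.integral_mono_on ht.le
        (((continuous_adjoint_comp (hT n) (g n) z).pow 2).intervalIntegrable _ _)
        (continuous_const.intervalIntegrable _ _) fun s hs => ?_
      rw [← sq_abs]
      refine pow_le_pow_left₀ (abs_nonneg _) ?_ 2
      refine (norm_adjoint_apply_le hC (hg n) _).trans ?_
      gcongr
      simpa using norm_adjoint_apply_le zero_le_one (by simpa using hT1 n s hs.1) z
    refine hle.trans (le_of_eq ?_)
    rw [intervalIntegral.integral_const, sub_zero, smul_eq_mul, mul_pow, mul_pow, mul_pow,
      Real.sq_sqrt ht.le]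
    ring
  have hΓb : ∀ n z, ‖Γ n z‖ ≤ D * √t * ‖z‖ := fun n z => by
    obtain ⟨u, hu, hub⟩ := hctrl' n z
    calc _ ≤ D * ‖z‖ * √t := hΓ n z u _ hu hub
      _ = _ := by ring
  obtain ⟨R', hR'⟩ := exists_isBlockDiag Ψ Ψ R hRb
  obtain ⟨Γ', hΓ'⟩ := exists_isBlockDiag Ψ Ψ Γ hΓb
  refine ⟨Γ', ⟨R', ⟨?_, fun h => ?_⟩, fun h => ⟨?_, ?_⟩⟩, ?_⟩
  · rw [ContinuousLinearMap.isPositive_def]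
    refine ⟨fun x y => ?_, fun x => ?_⟩
    · refine (hasSum_inner_coords Ψ (R' x) y).unique ?_
      refine (hasSum_inner_coords Ψ x (R' y)).congr_fun fun n => ?_
      rw [hR', hR', hRs]
    · exact (hasSum_inner_coords Ψ (R' x) x).nonneg fun n => by rw [hR']; exact hR0 n _
  · refine ext_coords Ψ fun n => ?_
    rw [hR', hR', hRR, coords_gramian hT hT1 hS hG hC hg ht.le]
  · refine ext_coords Ψ fun n => ?_
    rw [hR', hΓ', hRΓ, hS t ht.le]
  · have hker : LinearMap.ker (R' : H →ₗ[ℝ] H) = ⊥ := by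
      rw [LinearMap.ker_eq_bot']
      intro x hx
      change R' x = 0 at hx
      refine ext_coords Ψ fun n => hRinj n ?_
      rw [← hR', hx, map_zero]
      simp
    rw [hker, Submodule.bot_orthogonal_eq_top]
    trivial
  · refine ContinuousLinearMap.opNorm_le_bound _ (by positivity) fun v => ?_
    refine norm_le_of_coords Φ Ψ (by positivity) fun n => ?_
    rw [ContinuousLinearMap.comp_apply, hΓ', hV]
    obtain ⟨u, hu, hub⟩ := hctrl n (Φ v n)
    calc _ ≤ B * |Φ v n| * √t := hΓ n _ u _ hu hub
      _ = B * √t * ‖Φ v n‖ := by rw [Real.norm_eq_abs]; ring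

end Gramian

/-! ### Controls for the damped system -/

lemma flow_surjective (ω a t : ℝ) : Function.Surjective (flow ω a t) := fun z =>
  ⟨flow ω a (-t) z, by rw [← flow_add_apply, add_neg_cancel, flow_zero_apply]⟩

lemma controlExponent_eq (α β γ : ℝ) :
    controlExponent α β γ = 1 / 2 + max ((γ - β) / min α (1 - α)) 0 := by
  unfold controlExponent
  split_ifs with h
  · rw [min_eq_left (by linarith)]
  · rw [min_eq_right (by linarith)]

lemma IsCutoff.steers {C t : ℝ} {χ χ₁ χ₂ : ℝ → ℝ} (h : IsCutoff C t χ χ₁ χ₂) {m : ℝ} (hm : 0 < m)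
    (ρ α γ : ℝ) (z : Pair ℝ) :
    Steers (flow (m ^ (1 / 2 : ℝ)) (ρ * m ^ α)) (secondInput (m ^ (-γ))) t z fun s =>
      m ^ γ * steering (m ^ (1 / 2 : ℝ)) (ρ * m ^ (α - 1 / 2)) (χ₁ s) (χ₂ s)
        (flow (m ^ (1 / 2 : ℝ)) (ρ * m ^ α) s z) := by
  refine ⟨continuous_const.mul (continuous_steering h.continuous' h.continuous _ z),
    flow_add_integral_steering (d := ρ * m ^ (α - 1 / 2)) h (by positivity) ?_ z fun s => ?_⟩
  · rw [mul_assoc, ← Real.rpow_add hm]; congr 2; ring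
  · rw [← mul_assoc, ← Real.rpow_add hm, neg_add_cancel, Real.rpow_zero, one_mul]

/-- The modes of `Λ ^ (-β) v` can be steered to rest at a cost of order `t ^ (-θ)`, uniformly over
the modes, where `θ - 1/2 = ((γ - β) / min (α, 1 - α)) ∨ 0`; the additional factor `t ^ (-1/2)`
turns the energy bound into a pointwise bound on the control. -/
lemma exists_steers_bounds {δ ρ α β γ : ℝ} (hδ : 0 < δ) (hρ : 0 < ρ) (hα0 : 0 < α)
    (hα1 : α < 1) :
    ∃ c : ℝ, 0 < c ∧ ∀ t, 0 < t → ∃ D : ℝ, ∀ m, δ ≤ m →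
      (∀ x : ℝ, ∃ u, Steers (flow (m ^ (1 / 2 : ℝ)) (ρ * m ^ α)) (secondInput (m ^ (-γ))) t
        (secondInput (m ^ (-β)) x) u ∧
          ∀ s ∈ Icc 0 t, |u s| ≤ c / t / t ^ max ((γ - β) / min α (1 - α)) 0 * |x|) ∧
      ∀ z : Pair ℝ, ∃ u, Steers (flow (m ^ (1 / 2 : ℝ)) (ρ * m ^ α)) (secondInput (m ^ (-γ))) t
        z u ∧ ∀ s ∈ Icc 0 t, |u s| ≤ D * ‖z‖ := by
  set r := min α (1 - α)
  have hr : r ≤ α := min_le_left _ _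
  have hr' : r ≤ 1 - α := min_le_right _ _
  have hr0 : 0 < r := lt_min hα0 (by linarith)
  obtain ⟨C, hC, hcut⟩ := exists_isCutoff
  obtain ⟨K, k, hK, hk, hsteer⟩ := exists_steering_le hδ hρ hr hr' hC
  obtain ⟨L, hL, hexp⟩ := exists_rpow_mul_exp_le (q := γ - β) hδ hr0 hk
  refine ⟨K * L, by positivity, fun t ht => ?_⟩
  obtain ⟨χ, χ₁, χ₂, hχ⟩ := hcut t ht
  obtain ⟨D, -, hD⟩ := exists_rpow_mul_steering_le (γ := γ) hδ hρ hα0.le hr0 hr hr' hC ht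
  refine ⟨D, fun m hm => ?_⟩
  have hm0 : 0 < m := hδ.trans_le hm
  refine ⟨fun x => ⟨_, hχ.steers hm0 ρ α γ _, fun s hs => ?_⟩,
    fun z => ⟨_, hχ.steers hm0 ρ α γ z, fun s hs => ?_⟩⟩
  · rw [abs_mul, abs_of_pos (by positivity : 0 < m ^ γ)]
    have h1 := hsteer m hm t ht χ χ₁ χ₂ hχ s hs (secondInput (m ^ (-β)) x) rfl
    rw [norm_secondInput_apply, abs_of_pos (by positivity : 0 < m ^ (-β))] at h1
    calc _ ≤ m ^ γ * (K / t * Real.exp (-(k * (m ^ r * t))) * (m ^ (-β) * |x|)) := by gcongr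
      _ = K / t * (m ^ (γ - β) * Real.exp (-(k * (m ^ r * t)))) * |x| := by
        rw [sub_eq_add_neg, Real.rpow_add hm0]; ring
      _ ≤ K / t * (L / t ^ max ((γ - β) / r) 0) * |x| := by
        gcongr
        exact hexp m hm t ht
      _ = _ := by ring
  · rw [abs_mul, abs_of_pos (by positivity : 0 < m ^ γ)]
    exact hD m hm χ χ₁ χ₂ hχ s hs z

end DampedControl

end

theorem mainTheorem4 {U : Type*} [NormedAddCommGroup U] [InnerProductSpace ℝ U] [CompleteSpace U]
    [TopologicalSpace.SeparableSpace U]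
    (Λ : U →ₗ.[ℝ] U) (μ : ℕ → ℝ) (e : ℕ → U) (hΛ : DampedControl.IsPositiveDiscrete Λ μ e)
    (α ρ β γ T : ℝ) (hα0 : 0 < α) (hα1 : α < 1) (hρ : 0 < ρ) (hβ : 0 ≤ β) (hγ : 0 ≤ γ)
    (hT : 0 < T) :
    (∃ S : ℝ → DampedControl.Pair U →L[ℝ] DampedControl.Pair U,
      DampedControl.IsSemigroupOf (DampedControl.dampedOperator Λ ρ α) S) ∧
    ∀ S : ℝ → DampedControl.Pair U →L[ℝ] DampedControl.Pair U,
      DampedControl.IsSemigroupOf (DampedControl.dampedOperator Λ ρ α) S →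
      ∃ c : ℝ, 0 < c ∧ ∀ t ∈ Set.Ioc 0 T,
        (∀ v : U,
          DampedControl.minEnergy S (DampedControl.inputOperator Λ γ) t
              (DampedControl.inputOperator Λ β v) ≤
            ENNReal.ofReal (c * ‖v‖ / t ^ DampedControl.controlExponent α β γ)) ∧
        ∃ Γ : DampedControl.Pair U →L[ℝ] DampedControl.Pair U,
          DampedControl.IsGammaOperator S (DampedControl.inputOperator Λ γ) t Γ ∧
          ‖Γ ∘L DampedControl.inputOperator Λ β‖ ≤
            c / t ^ DampedControl.controlExponent α β γ := by
  obtain ⟨δ, hδ, hμ⟩ := hΛ.exists_lower_bound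
  obtain ⟨Φ, hΦ⟩ := hΛ.exists_coords
  have hpos : ∀ n, 0 < μ n := fun n => hδ.trans_le (hμ n)
  have hA := DampedControl.mem_graph_dampedOperator (ρ := ρ) hΦ hδ hμ hα1
  have hM : ∀ n t, 0 ≤ t → ∀ z,
      ‖DampedControl.expFlow (DampedControl.oscillator (μ n ^ (1 / 2 : ℝ)) (ρ * μ n ^ α)) t z‖ ≤
        ‖z‖ := fun n t ht z =>
    DampedControl.norm_flow_apply_le (mul_nonneg hρ.le (Real.rpow_nonneg (hpos n).le _)) ht z
  refine ⟨(DampedControl.exists_isSemigroupOf hA hM).imp fun _ h => h.1, fun S hS => ?_⟩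
  have hSd := fun t (ht : 0 ≤ t) => hS.isBlockDiag hA hM ht
  obtain ⟨c, hc, hctrl⟩ := DampedControl.exists_steers_bounds (β := β) (γ := γ) hδ hρ hα0 hα1
  refine ⟨c, hc, fun t ht => ?_⟩
  obtain ⟨D, hD⟩ := hctrl t ht.1
  set p := max ((γ - β) / min α (1 - α)) 0
  have hθ : c / t / t ^ p * √t = c / t ^ DampedControl.controlExponent α β γ := by
    have h1 : √t * √t = t := Real.mul_self_sqrt ht.1.le
    have h2 : 0 < √t := Real.sqrt_pos.2 ht.1
    have h3 : 0 < t ^ p := Real.rpow_pos_of_pos ht.1 p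
    have h4 : DampedControl.controlExponent α β γ = 1 / 2 + p :=
      DampedControl.controlExponent_eq α β γ
    rw [h4, Real.rpow_add ht.1, ← Real.sqrt_eq_rpow]
    nth_rewrite 1 [← h1]
    field_simp
  have hB : 0 ≤ c / t / t ^ p :=
    div_nonneg (div_nonneg hc.le ht.1.le) (Real.rpow_nonneg ht.1.le _)
  have hTc := fun n => DampedControl.continuous_flow (μ n ^ (1 / 2 : ℝ)) (ρ * μ n ^ α)
  have hG := DampedControl.isBlockDiag_inputOperator hΦ hδ hμ hγ
  have hV := DampedControl.isBlockDiag_inputOperator hΦ hδ hμ hβ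
  have hC : 0 ≤ δ ^ (-γ) := Real.rpow_nonneg hδ.le _
  have hg : ∀ n x, ‖DampedControl.secondInput (μ n ^ (-γ)) x‖ ≤ δ ^ (-γ) * ‖x‖ := fun n x => by
    rw [DampedControl.norm_secondInput_apply, abs_of_pos (Real.rpow_pos_of_pos (hpos n) _)]
    exact mul_le_mul_of_nonneg_right
      (Real.rpow_le_rpow_of_nonpos hδ (hμ n) (by linarith)) (abs_nonneg x)
  constructor
  · intro v
    refine (DampedControl.minEnergy_le hTc hM hSd hG hg hV ht.1.le hB
      (fun n => (hD (μ n) (hμ n)).1) v).trans (le_of_eq ?_)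
    rw [hθ, div_mul_eq_mul_div]
  · rw [← hθ]
    exact DampedControl.exists_isGammaOperator hTc hM hSd hG hC hg hV ht.1 hB
      (fun n => DampedControl.flow_surjective _ _ t)
      (fun n => (hD (μ n) (hμ n)).1) (fun n => (hD (μ n) (hμ n)).2)
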